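/- **Setting.** Let $H$ be a real separable Hilbert space and $V$ a real, reflexive, separable Banach space that is continuously and densely embedded in $H$; $V^*$ is its dual. Let $T\in(0,\infty)$, let $(\Omega,\mathcal F,(\mathcal F_t)_{t\in[0,T]},\mathbb P)$ be a filtered probability space satisfying the usual conditions, let $U$ be a real separable Hilbert space, let $Q\in\mathcal L(U)$ be symmetric and non-negative, and let $W$ be a (possibly cylindrical) $Q$-Wiener process with respect to $(\mathcal F_t)$. Let $U_0=Q^{1/2}(U)$ with inner product $(u,v)_{U_0}=(Q^{-1/2}u,Q^{-1/2}v)_U$, where $Q^{-1/2}$ is the pseudo-inverse, and let $\mathcal L_2(U_0,H)$ be the space of Hilbert–Schmidt operators with norm $\|L\|_{\mathcal L_2}^2=\operatorname{Tr}(L^*L)$. For $s\le t$ and an $\mathcal F_s$-measurable $\mathcal L_2(U_0,H)$-valued $\Phi$, $\Phi\,(W(t)-W(s))$ denotes the stochastic integral $\int_s^t\Phi\,dW$. **Operators.** Let $p\in(1,\infty)$, $\kappa,c\in[0,\infty)$, $\mu\in(0,\infty)$, $\nu\in[1,\infty)$. Let $A:V\times\Omega\to V^*$ and $B:V\times\Omega\to\mathcal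 L_2(U_0,H)$ be $\mathcal B(V)\otimes\mathcal F_0$-measurable, let $A$ be hemicontinuous ($\lambda\mapsto\langle A(u+\lambda v,\omega),w\rangle$ is continuous on $[0,1]$ for all $u,v,w\in V$, $\omega\in\Omega$), and suppose that on $\Omega$, for all $u,v\in V$, $$2\langle A(u)-A(v),u-v\rangle+\kappa\|u-v\|_H^2\ge\|B(u)-B(v)\|_{\mathcal L_2}^2,$$ $$2\langle A(v),v\rangle+\kappa\|v\|_H^2\ge\nu\|B(v)\|_{\mathcal L_2}^2+\mu\|v\|_V^p-c,\qquad \|A(v)\|_{V^*}\le c\,(1+\|v\|_V)^{p-1}.$$ **Scheme.** Let $V_h\subset V$ be a finite dimensional subspace, let $N\in\{1,2,\dots\}$, $k=T/N$, $t_n=nk$, and assume $2k\kappa<1$. Let $(X^n)_{n=0}^N$ be any $(\mathcal F_{t_n})_{n=0}^N$-adapted, $\mathbb P$-a.s. $V_h$-valued process such that $X^n\in L^2(\Omega,\mathcal F_{t_n},\mathbb P;H)$ and $B(X^n)\in L^2(\Omega,\mathcal F_{t_n},\mathbb P;\mathcal L_2(U_0,H))$ for $n\in\{0,1\}$, and such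 that for all $v\in V_h$ and $n=2,\dots,N$, with $\Delta_kW^n=W(t_n)-W(t_{n-1})$, $\mathbb P$-a.s. $$\Big(\tfrac32X^n-2X^{n-1}+\tfrac12X^{n-2},v\Big)_H+k\langle A(X^n),v\rangle=\Big(\tfrac32B(X^{n-1})\Delta_kW^n-\tfrac12B(X^{n-2})\Delta_kW^{n-1},v\Big)_H.$$ **Theorem.** Then $$\max_{n\in\{2,\dots,N\}}\Big(\mathbb E\|X^n\|_H^2+2k\nu\,\mathbb E\|B(X^n)\|_{\mathcal L_2}^2\Big)+2k\mu\sum_{n=2}^N\mathbb E\|X^n\|_V^p+\frac{\nu-1}{\nu}\sum_{n=2}^N\mathbb E\|X^n-2X^{n-1}+X^{n-2}\|_H^2$$ $$\le C_k\Big(T+\sum_{n=0}^1\mathbb E\|X^n\|_H^2+k\sum_{n=0}^1\mathbb E\|B(X^n)\|_{\mathcal L_2}^2\Big),$$ where $C_k=2\max\{2c,11,2\nu\}\,(1-2k\kappa)^{-1}e^{2\kappa T(1-2k\kappa)^{-1}}$. (For $N=1$ the maximum and the sums over the empty range are $0$.) In particular, all expectations on the left-hand side are finite whenever their coefficients are positive.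 -/

import Mathlib

open MeasureTheory ProbabilityTheory Filter Topology
open scoped ENNReal

noncomputable section

/-! ### The Cameron–Martin space `U₀ = Q^{1/2}(U)` -/

section CameronMartin

variable {U : Type*} [NormedAddCommGroup U] [InnerProductSpace ℝ U] [CompleteSpace U]

/-- The vector space `S(U)`, where `S = Q^{1/2}`. It carries the inner product
`(u, v) ↦ (S⁻¹ u, S⁻¹ v)_U`, where `S⁻¹` is the pseudo-inverse of `S` (and not the inner product
that it would inherit as a subspace of `U`). -/
def CameronMartin (S : U →L[ℝ] U) : Type _ := LinearMap.range (S : U →ₗ[ℝ] U)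

namespace CameronMartin

variable (S : U →L[ℝ] U)

instance : AddCommGroup (CameronMartin S) :=
  inferInstanceAs (AddCommGroup (LinearMap.range (S : U →ₗ[ℝ] U)))

instance : Module ℝ (CameronMartin S) :=
  inferInstanceAs (Module ℝ (LinearMap.range (S : U →ₗ[ℝ] U)))

/-- The inclusion `U₀ ⊆ U`. -/
def toU : CameronMartin S →ₗ[ℝ] U := (LinearMap.range (S : U →ₗ[ℝ] U)).subtype

theorem isCompl_ker : IsCompl (LinearMap.ker (S : U →ₗ[ℝ] U))ᗮ (LinearMap.ker (S : U →ₗ[ℝ] U)) := by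
  have : (LinearMap.ker (S : U →ₗ[ℝ] U)).HasOrthogonalProjection := by
    have : IsClosed ((LinearMap.ker (S : U →ₗ[ℝ] U) : Submodule ℝ U) : Set U) := S.isClosed_ker
    have : CompleteSpace (LinearMap.ker (S : U →ₗ[ℝ] U)) := this.completeSpace_coe
    infer_instance
  exact (Submodule.isCompl_orthogonal _).symm

/-- The pseudo-inverse of `S` on its range, with values in `(ker S)ᗮ`. -/
def pinvEquiv : CameronMartin S ≃ₗ[ℝ] (LinearMap.ker (S : U →ₗ[ℝ] U))ᗮ :=
  (LinearMap.kerComplementEquivRange (S : U →ₗ[ℝ] U) (isCompl_ker S)).symm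

/-- The pseudo-inverse of `S` on its range: `pinv S u` is the unique `x ∈ (ker S)ᗮ` with
`S x = u`. -/
def pinv : CameronMartin S →ₗ[ℝ] U :=
  (LinearMap.ker (S : U →ₗ[ℝ] U))ᗮ.subtype ∘ₗ (pinvEquiv S).toLinearMap

theorem pinv_mem (u : CameronMartin S) : pinv S u ∈ (LinearMap.ker (S : U →ₗ[ℝ] U))ᗮ :=
  (pinvEquiv S u).2

theorem apply_pinv (u : CameronMartin S) : S (pinv S u) = toU S u :=
  congrArg Subtype.val
    ((LinearMap.kerComplementEquivRange (S : U →ₗ[ℝ] U) (isCompl_ker S)).apply_symm_apply u)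

theorem pinv_injective : Function.Injective (pinv S) :=
  Subtype.val_injective.comp (pinvEquiv S).injective

instance : NormedAddCommGroup (CameronMartin S) :=
  NormedAddCommGroup.induced _ _ (pinv S) (pinv_injective S)

instance : InnerProductSpace ℝ (CameronMartin S) where
  toNormedSpace := NormedSpace.induced ℝ (CameronMartin S) U (pinv S)
  inner u v := inner ℝ (pinv S u) (pinv S v)
  norm_sq_eq_re_inner u := norm_sq_eq_re_inner (𝕜 := ℝ) (pinv S u)
  conj_inner_symm u v := inner_conj_symm (𝕜 := ℝ) (pinv S u) (pinv S v)
  add_left u v w := by rw [map_add, inner_add_left]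
  smul_left u v r := by rw [map_smul, inner_smul_left]

instance : CompleteSpace (CameronMartin S) := by
  have : CompleteSpace (LinearMap.ker (S : U →ₗ[ℝ] U))ᗮ :=
    (Submodule.isClosed_orthogonal _).completeSpace_coe
  let e : CameronMartin S ≃ₗᵢ[ℝ] (LinearMap.ker (S : U →ₗ[ℝ] U))ᗮ :=
    ⟨pinvEquiv S, fun _ => rfl⟩
  exact (completeSpace_congr (e := e.toLinearEquiv.toEquiv) e.isometry.isUniformEmbedding).2 this

end CameronMartin

end CameronMartin

/-! ### Hilbert–Schmidt operators -/

section HilbertSchmidt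

variable (E F : Type*) [NormedAddCommGroup E] [InnerProductSpace ℝ E] [CompleteSpace E]
  [NormedAddCommGroup F] [InnerProductSpace ℝ F]

/-- The index set of an auxiliary orthonormal basis of `E`. -/
def HSIndex : Set E := (exists_hilbertBasis ℝ E).choose

/-- An auxiliary orthonormal basis of `E`. -/
def hsBasis : HilbertBasis (HSIndex E) ℝ E := (exists_hilbertBasis ℝ E).choose_spec.choose

/-- The bounded operators `L` with `Tr (L* L) = ∑ⱼ ‖L eⱼ‖² < ∞`. -/
def hsSubmodule : Submodule ℝ (E →L[ℝ] F) where
  carrier := {L | Memℓp (fun i => L (hsBasis E i)) 2}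
  add_mem' hL hM := hL.add hM
  zero_mem' := zero_memℓp
  smul_mem' r _ hL := hL.const_smul r

/-- The space `ℒ₂(E, F)` of Hilbert–Schmidt operators, with the Hilbert–Schmidt norm
`‖L‖² = ∑ⱼ ‖L eⱼ‖²`, which does not depend on the orthonormal basis `(eⱼ)`
(see `HilbertSchmidt.hasSum_sq`). -/
def HilbertSchmidt : Type _ := hsSubmodule E F

namespace HilbertSchmidt

instance : AddCommGroup (HilbertSchmidt E F) := inferInstanceAs (AddCommGroup (hsSubmodule E F))

instance : Module ℝ (HilbertSchmidt E F) := inferInstanceAs (Module ℝ (hsSubmodule E F))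

/-- A Hilbert–Schmidt operator as a bounded operator. -/
def toCLM : HilbertSchmidt E F →ₗ[ℝ] (E →L[ℝ] F) := (hsSubmodule E F).subtype

/-- The family of the values of an operator on the auxiliary basis. -/
def toLp : HilbertSchmidt E F →ₗ[ℝ] lp (fun _ : HSIndex E => F) 2 where
  toFun L := ⟨fun i => toCLM E F L (hsBasis E i), L.2⟩
  map_add' _ _ := rfl
  map_smul' _ _ := rfl

theorem toLp_injective : Function.Injective (toLp E F) := by
  intro L M h
  have h1 : ∀ i, toCLM E F L (hsBasis E i) = toCLM E F M (hsBasis E i) := fun i =>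
    congrFun (congrArg Subtype.val h) i
  apply Subtype.val_injective
  apply ContinuousLinearMap.ext_on
    (Submodule.dense_iff_topologicalClosure_eq_top.2 (hsBasis E).dense_span)
  rintro _ ⟨i, rfl⟩
  exact h1 i

instance : NormedAddCommGroup (HilbertSchmidt E F) :=
  NormedAddCommGroup.induced _ _ (toLp E F) (toLp_injective E F)

instance : NormedSpace ℝ (HilbertSchmidt E F) :=
  NormedSpace.induced ℝ (HilbertSchmidt E F) _ (toLp E F)

instance : MeasurableSpace (HilbertSchmidt E F) := borel _

instance : BorelSpace (HilbertSchmidt E F) := ⟨rfl⟩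

instance : CoeFun (HilbertSchmidt E F) (fun _ => E → F) := ⟨fun L => toCLM E F L⟩

variable {E F}

theorem tsum_sq_inner {G ι : Type*} [NormedAddCommGroup G] [InnerProductSpace ℝ G]
    (b : HilbertBasis ι ℝ G) (x : G) :
    ∑' i, ENNReal.ofReal ((inner ℝ x (b i)) ^ 2) = ENNReal.ofReal (‖x‖ ^ 2) := by
  have h : HasSum (fun i => (inner ℝ x (b i)) ^ 2) (‖x‖ ^ 2) := by
    have h1 := b.hasSum_inner_mul_inner x x
    rw [real_inner_self_eq_norm_sq] at h1
    have h2 : (fun i => (inner ℝ x (b i)) ^ 2) = fun i => inner ℝ x (b i) * inner ℝ (b i) x := by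
      funext i
      rw [real_inner_comm x (b i), sq]
    rwa [h2]
  rw [← h.tsum_eq, ENNReal.ofReal_tsum_of_nonneg (fun _ => sq_nonneg _) h.summable]

theorem tsum_norm_sq_eq [CompleteSpace F] {ι κ : Type*} (b : HilbertBasis ι ℝ E)
    (f : HilbertBasis κ ℝ F) (L : E →L[ℝ] F) :
    ∑' i, ENNReal.ofReal (‖L (b i)‖ ^ 2) =
      ∑' j, ENNReal.ofReal (‖ContinuousLinearMap.adjoint L (f j)‖ ^ 2) := by
  simp_rw [← tsum_sq_inner f, ← tsum_sq_inner b]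
  rw [ENNReal.tsum_comm]
  simp_rw [ContinuousLinearMap.adjoint_inner_left, real_inner_comm]

/-- The Hilbert–Schmidt norm can be computed in any orthonormal basis. -/
theorem hasSum_sq [CompleteSpace F] {ι : Type*} (b : HilbertBasis ι ℝ E)
    (L : HilbertSchmidt E F) : HasSum (fun i => ‖L (b i)‖ ^ 2) (‖L‖ ^ 2) := by
  have h0 : HasSum (fun i => ‖L (hsBasis E i)‖ ^ 2) (‖L‖ ^ 2) := by
    have h := lp.hasSum_norm (p := 2) (by norm_num) (toLp E F L)
    simp only [ENNReal.toReal_ofNat, Real.rpow_ofNat] at h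
    exact h
  obtain ⟨_, f, _⟩ := exists_hilbertBasis ℝ F
  have h1 : ∑' i, ENNReal.ofReal (‖L (b i)‖ ^ 2) = ENNReal.ofReal (‖L‖ ^ 2) := by
    rw [tsum_norm_sq_eq b f, ← tsum_norm_sq_eq (hsBasis E) f, ← h0.tsum_eq,
      ENNReal.ofReal_tsum_of_nonneg (fun _ => sq_nonneg _) h0.summable]
  have h2 : HasSum (fun i => (‖L (b i)‖ ^ 2).toNNReal) (‖L‖ ^ 2).toNNReal := by
    rw [← ENNReal.hasSum_coe]
    change HasSum (fun i => ENNReal.ofReal (‖L (b i)‖ ^ 2)) (ENNReal.ofReal (‖L‖ ^ 2))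
    rw [← h1]
    exact ENNReal.summable.hasSum
  have h3 := NNReal.hasSum_coe.2 h2
  simpa [Real.coe_toNNReal _ (sq_nonneg _)] using h3

end HilbertSchmidt

end HilbertSchmidt

/-! ### Wiener processes and the increments `Φ ΔW` -/

section Wiener

variable {U Ω : Type*} [NormedAddCommGroup U] [InnerProductSpace ℝ U]
  {m : MeasurableSpace Ω} {T : ℝ}

/-- `W` is a (possibly cylindrical) `Q`-Wiener process on `[0, T]` with respect to the
filtration `F`, where `W t u` stands for `(W(t), u)_U`. If `Q` has finite trace, then a `U`-valued
`Q`-Wiener process `W` gives such a family through `W t u ω = (W(t, ω), u)_U`. -/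
structure IsWienerProcess (P : Measure Ω) (F : Filtration (Set.Icc (0 : ℝ) T) m) (Q : U →L[ℝ] U)
    (W : Set.Icc (0 : ℝ) T → U → Ω → ℝ) : Prop where
  /-- `W` is adapted. -/
  adapted : ∀ t u, Measurable[F t] (W t u)
  /-- `W(t)` is linear. -/
  linear : ∀ t (a b : ℝ) (u v : U),
    W t (a • u + b • v) =ᵐ[P] fun ω => a * W t u ω + b * W t v ω
  /-- `W(0) = 0`. -/
  zero : ∀ (t : Set.Icc (0 : ℝ) T) (u : U), (t : ℝ) = 0 → W t u =ᵐ[P] 0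
  /-- The paths are continuous. -/
  continuous : ∀ u, ∀ᵐ ω ∂P, Continuous fun t : Set.Icc (0 : ℝ) T => W t u ω
  /-- `W(t) - W(s)` is a centred Gaussian with covariance operator `(t - s) Q`. -/
  gaussian : ∀ s t : Set.Icc (0 : ℝ) T, s ≤ t → ∀ u, P.map (fun ω => W t u ω - W s u ω) =
    gaussianReal 0 (((t : ℝ) - s) * inner ℝ (Q u) u).toNNReal
  /-- `W(t) - W(s)` is independent of `F s`. -/
  indep : ∀ s t : Set.Icc (0 : ℝ) T, s ≤ t →
    Indep (⨆ u, MeasurableSpace.comap (fun ω => W t u ω - W s u ω) inferInstance) (F s) P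

/-- `D = Φ (W(t) - W(s))`, for a random `Φ` with values in `ℒ₂(U₀, H)`, `U₀ = S(U)`, `S ∘ S = Q`.
For an orthonormal basis `(eⱼ)` of `U₀` of the form `eⱼ = Q uⱼ` (such a basis exists, because
`Q(U)` is dense in the separable Hilbert space `U₀`) the coefficient of `W(t) - W(s)` at `eⱼ` is
`(W(t) - W(s), eⱼ)_{U₀} = (W(t) - W(s), uⱼ)_U`, so that
`Φ (W(t) - W(s)) = ∑ⱼ (W(t) - W(s), uⱼ)_U Φ eⱼ`, with convergence in probability. If `Φ` is
`F s`-measurable, this is the Itô integral of the constant integrand `Φ` over `[s, t]`. It does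
not depend on the basis. -/
def IsNoiseIncrement [CompleteSpace U] {H : Type*} [NormedAddCommGroup H] [InnerProductSpace ℝ H]
    (P : Measure Ω) (Q S : U →L[ℝ] U) (W : Set.Icc (0 : ℝ) T → U → Ω → ℝ)
    (Φ : Ω → HilbertSchmidt (CameronMartin S) H) (s t : Set.Icc (0 : ℝ) T) (D : Ω → H) : Prop :=
  ∃ (J : Type) (_ : Countable J) (e : HilbertBasis J ℝ (CameronMartin S)) (u : J → U),
    (∀ j, CameronMartin.toU S (e j) = Q (u j)) ∧
    TendstoInMeasure P
      (fun (I : Finset J) ω => ∑ j ∈ I, (W t (u j) ω - W s (u j) ω) • Φ ω (e j)) atTop D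

end Wiener

/-! ### The operators and the scheme -/

section Scheme

variable {U V H Ω : Type*} [NormedAddCommGroup U] [InnerProductSpace ℝ U] [CompleteSpace U]
  [NormedAddCommGroup V] [NormedSpace ℝ V]
  [NormedAddCommGroup H] [InnerProductSpace ℝ H]
  {m : MeasurableSpace Ω} {T : ℝ}

/-- The assumptions on the operators `A : V × Ω → V*` and `B : V × Ω → ℒ₂(U₀, H)`, where
`V` is regarded as a subspace of `H` through the embedding `ι` and `F₀` is the initial
σ-algebra. -/
structure OperatorAssumptions [MeasurableSpace V] (ι : V →L[ℝ] H) (F₀ : MeasurableSpace Ω)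
    (S : U →L[ℝ] U) (A : V → Ω → StrongDual ℝ V)
    (B : V → Ω → HilbertSchmidt (CameronMartin S) H) (p κ c μ ν : ℝ) : Prop where
  κ_nonneg : 0 ≤ κ
  c_nonneg : 0 ≤ c
  μ_pos : 0 < μ
  one_le_ν : 1 ≤ ν
  measurable_A : Measurable[Prod.instMeasurableSpace (m₂ := F₀)] fun q : V × Ω => A q.1 q.2
  measurable_B : Measurable[Prod.instMeasurableSpace (m₂ := F₀)] fun q : V × Ω => B q.1 q.2
  hemicontinuous : ∀ (u v w : V) (ω : Ω),
    ContinuousOn (fun r : ℝ => A (u + r • v) ω w) (Set.Icc 0 1)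
  monotone : ∀ (u v : V) (ω : Ω),
    ‖B u ω - B v ω‖ ^ 2 ≤ 2 * (A u ω - A v ω) (u - v) + κ * ‖ι (u - v)‖ ^ 2
  coercive : ∀ (v : V) (ω : Ω),
    ν * ‖B v ω‖ ^ 2 + μ * ‖v‖ ^ p - c ≤ 2 * A v ω v + κ * ‖ι v‖ ^ 2
  growth : ∀ (v : V) (ω : Ω), ‖A v ω‖ ≤ c * (1 + ‖v‖) ^ (p - 1)

/-- The element of `V` that represents a given element of `ι(V) ⊆ H` (an irrelevant value
outside `ι(V)`). -/
def toV (ι : V →L[ℝ] H) : H → V := Function.invFun ι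

/-- The grid point `tₙ = n k` with `k = T / N`, for `n ≤ N`. -/
def gridPoint (hT : 0 < T) (N n : ℕ) : Set.Icc (0 : ℝ) T :=
  Set.projIcc 0 T hT.le (n * (T / N))

/-- The process `X⁰, …, X^N` solves the BDF2-Maruyama scheme with the step size `k = T / N` in the
subspace `Vh`. Here `D n` is the random variable `B(X^{n-1}) (W(tₙ) - W(tₙ₋₁))`. -/
def SolvesBDF2 (ι : V →L[ℝ] H) (P : Measure Ω) (hT : 0 < T) (Q S : U →L[ℝ] U)
    (W : Set.Icc (0 : ℝ) T → U → Ω → ℝ) (A : V → Ω → StrongDual ℝ V)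
    (B : V → Ω → HilbertSchmidt (CameronMartin S) H) (Vh : Submodule ℝ V) (N : ℕ)
    (X : ℕ → Ω → H) : Prop :=
  ∃ D : ℕ → Ω → H,
    (∀ n, 1 ≤ n → n ≤ N → IsNoiseIncrement P Q S W (fun ω => B (toV ι (X (n - 1) ω)) ω)
      (gridPoint hT N (n - 1)) (gridPoint hT N n) (D n)) ∧
    ∀ n, 2 ≤ n → n ≤ N → ∀ v ∈ Vh, ∀ᵐ ω ∂P,
      inner ℝ ((3 / 2 : ℝ) • X n ω - (2 : ℝ) • X (n - 1) ω + (1 / 2 : ℝ) • X (n - 2) ω) (ι v)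
          + T / N * A (toV ι (X n ω)) ω v
        = inner ℝ ((3 / 2 : ℝ) • D n ω - (1 / 2 : ℝ) • D (n - 1) ω) (ι v)

end Scheme

end

/-!
The scheme is tested with `v = X n`. Write `D n` for the noise increment `B (X (n - 1)) ΔW n` and
`d n` for the second difference `X n - 2 X (n - 1) + X (n - 2)`. By the `G`-stability identity
(`four_mul_inner_bdf2`), four times the discrete derivative tested with `X n` is the increment of
`‖X n‖² + ‖2 X n - X (n - 1)‖²` plus `‖d n‖²`, and coercivity bounds `4 k ⟨A (X n), X n⟩` from below.

The noise term is `(6 D n - 2 D (n - 1), X n)`. Since `D n` is orthogonal in `L²` to everything that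
is measurable at step `n - 1`, its expectation is
`2 E(D n - D (n - 1), d n) + 4 E(D n, X n) - 4 E(D (n - 1), X (n - 1))`
(`IsEnergyScheme.integral_energy_le`). The last two terms telescope. By Young's inequality with the
weight `ν` and the Itô isometry, the first one is at most
`ν k (E‖B (X (n - 1))‖² + E‖B (X (n - 2))‖²) + ν⁻¹ E‖d n‖²`, which the left-hand side absorbs after
summation (`sum_energy_le`). The boundary term `4 E(D n, X n) = 2 E(D n, 2 X n - X (n - 1))` is absorbed
by `E‖2 X n - X (n - 1)‖²` and `E‖B (X (n - 1))‖²`. A discrete Gronwall inequality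
(`add_sum_le_mul_exp`) then removes the term with `κ`. The maximum and the sums on the left-hand side
are each bounded by half of the right-hand side.

The expectations may be manipulated as real numbers because they are finite: the same tested
equation bounds `‖X n‖²`, `‖B (X n)‖²` and `‖X n‖_V ^ p` pathwise by integrable quantities from the two
preceding steps (`IsEnergyScheme.integrable_succ`).

The facts about `D n` are those of the Itô integral of a constant integrand
(`IsNoiseIncrement.properties`). They come from its series expansion: the coefficients of the noise
along an orthonormal basis `eⱼ = Q uⱼ` of `U₀` are centred, uncorrelated, and independent of the
integrand, so that partial sums obey the Itô isometry exactly, and Fatou's lemma transfers its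
upper bound to the limit in probability and to the remainders of the series.
-/

/-! ### Square-integrable random variables -/

section SquareIntegrable

variable {Ω E H : Type*} {m : MeasurableSpace Ω} {P : Measure Ω} [NormedAddCommGroup E]
  [NormedAddCommGroup H] [InnerProductSpace ℝ H]

theorem integrable_inner_of_memLp_two {f g : Ω → H} (hf : MemLp f 2 P) (hg : MemLp g 2 P) :
    Integrable (fun ω => inner ℝ (f ω) (g ω)) P :=
  (hf.norm.integrable_mul hg.norm).mono' (hf.1.inner hg.1)
    (ae_of_all _ fun ω => norm_inner_le_norm (f ω) (g ω))

theorem integrable_sq_norm_of_memLp_two {f : Ω → E} (hf : MemLp f 2 P) :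
    Integrable (fun ω => ‖f ω‖ ^ 2) P :=
  (memLp_two_iff_integrable_sq_norm hf.1).1 hf

theorem eLpNorm_two_eq_ofReal_sqrt {f : Ω → E} (hf : MemLp f 2 P) :
    eLpNorm f 2 P = ENNReal.ofReal (√(∫ ω, ‖f ω‖ ^ 2 ∂P)) := by
  rw [hf.eLpNorm_eq_integral_rpow_norm (by norm_num) (by norm_num), Real.sqrt_eq_rpow]
  norm_num

/-- Young's inequality `2 E(f, g) ≤ a E|f|² + a⁻¹ E|g|²`. -/
theorem two_mul_integral_inner_le {f g : Ω → H} (hf : MemLp f 2 P) (hg : MemLp g 2 P)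
    {a : ℝ} (ha : 0 < a) :
    2 * ∫ ω, inner ℝ (f ω) (g ω) ∂P ≤ a * ∫ ω, ‖f ω‖ ^ 2 ∂P + a⁻¹ * ∫ ω, ‖g ω‖ ^ 2 ∂P := by
  have hf2 := (integrable_sq_norm_of_memLp_two hf).const_mul a
  have hg2 := (integrable_sq_norm_of_memLp_two hg).const_mul a⁻¹
  rw [← integral_const_mul, ← integral_const_mul, ← integral_const_mul, ← integral_add hf2 hg2]
  refine integral_mono ((integrable_inner_of_memLp_two hf hg).const_mul 2) (hf2.add hg2) fun ω => ?_
  have h := real_inner_le_norm (f ω) (g ω)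
  have h1 : 0 ≤ a⁻¹ * (a * ‖f ω‖ - ‖g ω‖) ^ 2 := by positivity
  have h2 : a⁻¹ * (a * ‖f ω‖ - ‖g ω‖) ^ 2
      = a * ‖f ω‖ ^ 2 + a⁻¹ * ‖g ω‖ ^ 2 - 2 * (‖f ω‖ * ‖g ω‖) := by
    field_simp
    ring
  change 2 * inner ℝ (f ω) (g ω) ≤ a * ‖f ω‖ ^ 2 + a⁻¹ * ‖g ω‖ ^ 2
  linarith

theorem lintegral_enorm_sq_eq_ofReal {f : Ω → E} (hf : Integrable (fun ω => ‖f ω‖ ^ 2) P) :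
    ∫⁻ ω, ‖f ω‖ₑ ^ 2 ∂P = ENNReal.ofReal (∫ ω, ‖f ω‖ ^ 2 ∂P) := by
  rw [ofReal_integral_eq_lintegral_ofReal hf (ae_of_all _ fun _ => sq_nonneg _)]
  refine lintegral_congr fun ω => ?_
  rw [ENNReal.ofReal_pow (norm_nonneg _), ofReal_norm]

end SquareIntegrable

/-! ### Series of independent noise coefficients -/

section NoiseSeries

variable {Ω H J : Type*} {m₁ m₂ m₃ m : MeasurableSpace Ω} {P : Measure[m] Ω}
  [NormedAddCommGroup H] [InnerProductSpace ℝ H]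

theorem indepFun_of_measurable {β γ : Type*} [MeasurableSpace β] [MeasurableSpace γ]
    (h : Indep m₁ m₂ P) {f : Ω → β} {g : Ω → γ}
    (hf : Measurable[m₁] f) (hg : Measurable[m₂] g) : IndepFun f g P :=
  (IndepFun_iff_Indep f g P).2
    (indep_of_indep_of_le_right (indep_of_indep_of_le_left h hf.comap_le) hg.comap_le)

/-- Real coefficients `ξⱼ`, centred and uncorrelated with variance `τ`, which are independent of
the square-integrable vectors `φⱼ`. The independence is expressed through two independent
σ-algebras `m₁` and `m₂` with respect to which the `ξⱼ` and the `φⱼ` are measurable. -/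
structure IsNoiseFamily (P : Measure[m] Ω) (m₁ m₂ : MeasurableSpace Ω) (τ : ℝ) (ξ : J → Ω → ℝ)
    (φ : J → Ω → H) : Prop where
  le_left : m₁ ≤ m
  le_right : m₂ ≤ m
  indep : Indep m₁ m₂ P
  measurable_coeff : ∀ j, Measurable[m₁] (ξ j)
  memLp_coeff : ∀ j, MemLp (ξ j) 2 P
  integral_coeff : ∀ j, ∫ ω, ξ j ω ∂P = 0
  integral_coeff_sq : ∀ j, ∫ ω, ξ j ω * ξ j ω ∂P = τ
  integral_coeff_mul : ∀ i j, i ≠ j → ∫ ω, ξ i ω * ξ j ω ∂P = 0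
  measurable_vec : ∀ j, StronglyMeasurable[m₂] (φ j)
  memLp_vec : ∀ j, MemLp (φ j) 2 P

namespace IsNoiseFamily

variable {τ : ℝ} {ξ : J → Ω → ℝ} {φ : J → Ω → H}

theorem memLp_smul (h : IsNoiseFamily P m₁ m₂ τ ξ φ) (j : J) :
    MemLp (fun ω => ξ j ω • φ j ω) 2 P := by
  have hm : AEStronglyMeasurable (fun ω => ξ j ω • φ j ω) P :=
    (h.memLp_coeff j).1.smul (h.memLp_vec j).1
  rw [memLp_two_iff_integrable_sq_norm hm]
  have hi : IndepFun (fun ω => ‖ξ j ω‖ ^ 2) (fun ω => ‖φ j ω‖ ^ 2) P :=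
    indepFun_of_measurable h.indep ((measurable_norm.pow_const 2).comp (h.measurable_coeff j))
      ((h.measurable_vec j).norm.measurable.pow_const 2)
  have := hi.integrable_mul (integrable_sq_norm_of_memLp_two (h.memLp_coeff j))
    (integrable_sq_norm_of_memLp_two (h.memLp_vec j))
  refine this.congr (ae_of_all _ fun ω => ?_)
  simp [norm_smul, mul_pow]

theorem memLp_sum (h : IsNoiseFamily P m₁ m₂ τ ξ φ) (K : Finset J) :
    MemLp (fun ω => ∑ j ∈ K, ξ j ω • φ j ω) 2 P :=
  memLp_finsetSum K fun j _ => h.memLp_smul j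

theorem integral_norm_sq_sum (h : IsNoiseFamily P m₁ m₂ τ ξ φ) (K : Finset J) :
    ∫ ω, ‖∑ j ∈ K, ξ j ω • φ j ω‖ ^ 2 ∂P = τ * ∑ j ∈ K, ∫ ω, ‖φ j ω‖ ^ 2 ∂P := by
  classical
  have hij : ∀ i j, ∫ ω, inner ℝ (ξ i ω • φ i ω) (ξ j ω • φ j ω) ∂P
      = (∫ ω, ξ i ω * ξ j ω ∂P) * ∫ ω, inner ℝ (φ i ω) (φ j ω) ∂P := by
    intro i j
    have hi : IndepFun (fun ω => ξ i ω * ξ j ω) (fun ω => inner ℝ (φ i ω) (φ j ω)) P :=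
      indepFun_of_measurable h.indep ((h.measurable_coeff i).mul (h.measurable_coeff j))
        ((h.measurable_vec i).inner (h.measurable_vec j)).measurable
    rw [← hi.integral_mul_eq_mul_integral ((h.memLp_coeff i).1.mul (h.memLp_coeff j).1)
      ((h.memLp_vec i).1.inner (h.memLp_vec j).1)]
    refine integral_congr_ae (ae_of_all _ fun ω => ?_)
    simp only [real_inner_smul_left, real_inner_smul_right, Pi.mul_apply]
    ring
  have hint : ∀ i j, Integrable (fun ω => inner ℝ (ξ i ω • φ i ω) (ξ j ω • φ j ω)) P :=
    fun i j => integrable_inner_of_memLp_two (h.memLp_smul i) (h.memLp_smul j)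
  calc ∫ ω, ‖∑ j ∈ K, ξ j ω • φ j ω‖ ^ 2 ∂P
      = ∫ ω, ∑ i ∈ K, ∑ j ∈ K, inner ℝ (ξ i ω • φ i ω) (ξ j ω • φ j ω) ∂P := by
        refine integral_congr_ae (ae_of_all _ fun ω => ?_)
        simp only [← real_inner_self_eq_norm_sq, sum_inner, inner_sum]
        exact Finset.sum_comm
    _ = ∑ i ∈ K, ∑ j ∈ K, ∫ ω, inner ℝ (ξ i ω • φ i ω) (ξ j ω • φ j ω) ∂P := by
        rw [integral_finsetSum _ fun i _ => integrable_finsetSum _ fun j _ => hint i j]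
        exact Finset.sum_congr rfl fun i _ => integral_finsetSum _ fun j _ => hint i j
    _ = ∑ i ∈ K, τ * ∫ ω, ‖φ i ω‖ ^ 2 ∂P := by
        refine Finset.sum_congr rfl fun i hi => ?_
        rw [Finset.sum_eq_single_of_mem i hi, hij, h.integral_coeff_sq]
        · simp only [real_inner_self_eq_norm_sq]
        · intro j _ hj
          rw [hij, h.integral_coeff_mul i j hj.symm, zero_mul]
    _ = τ * ∑ j ∈ K, ∫ ω, ‖φ j ω‖ ^ 2 ∂P := (Finset.mul_sum _ _ _).symm

theorem integral_inner_sum (h : IsNoiseFamily P m₁ m₂ τ ξ φ) (K : Finset J) {Y : Ω → H}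
    (hY : AEStronglyMeasurable[m₂] Y P) (hY2 : MemLp Y 2 P) :
    ∫ ω, inner ℝ (∑ j ∈ K, ξ j ω • φ j ω) (Y ω) ∂P = 0 := by
  simp only [sum_inner]
  rw [integral_finsetSum _ fun j _ => integrable_inner_of_memLp_two (h.memLp_smul j) hY2]
  refine Finset.sum_eq_zero fun j _ => ?_
  have hi : IndepFun (ξ j) (fun ω => inner ℝ (φ j ω) (hY.mk Y ω)) P :=
    indepFun_of_measurable h.indep (h.measurable_coeff j)
      ((h.measurable_vec j).inner hY.stronglyMeasurable_mk).measurable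
  calc ∫ ω, inner ℝ (ξ j ω • φ j ω) (Y ω) ∂P
      = ∫ ω, (ξ j * fun ω => inner ℝ (φ j ω) (hY.mk Y ω)) ω ∂P := by
        refine integral_congr_ae ?_
        filter_upwards [hY.ae_eq_mk] with ω hω
        rw [hω, real_inner_smul_left, Pi.mul_apply]
    _ = 0 := by
        rw [hi.integral_mul_eq_mul_integral (h.memLp_coeff j).1
          (((h.measurable_vec j).mono h.le_right).inner
            (hY.stronglyMeasurable_mk.mono h.le_right)).aestronglyMeasurable,
          h.integral_coeff, zero_mul]

variable [Countable J] {D : Ω → H}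

/-- The distance of the sum of the series to a partial sum, by Fatou's lemma along the finite sets
that contain `I`. -/
theorem memLp_sub_and_integral_le (h : IsNoiseFamily P m₁ m₂ τ ξ φ) (hτ : 0 ≤ τ)
    (hs : Summable fun j => ∫ ω, ‖φ j ω‖ ^ 2 ∂P)
    (hD : TendstoInMeasure P (fun (I : Finset J) ω => ∑ j ∈ I, ξ j ω • φ j ω) atTop D)
    (I : Finset J) :
    MemLp (fun ω => D ω - ∑ j ∈ I, ξ j ω • φ j ω) 2 P ∧
      ∫ ω, ‖D ω - ∑ j ∈ I, ξ j ω • φ j ω‖ ^ 2 ∂P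
        ≤ τ * (∑' j, ∫ ω, ‖φ j ω‖ ^ 2 ∂P - ∑ j ∈ I, ∫ ω, ‖φ j ω‖ ^ 2 ∂P) := by
  classical
  set R := τ * (∑' j, ∫ ω, ‖φ j ω‖ ^ 2 ∂P - ∑ j ∈ I, ∫ ω, ‖φ j ω‖ ^ 2 ∂P) with hR
  have h0 : ∀ j, 0 ≤ ∫ ω, ‖φ j ω‖ ^ 2 ∂P := fun j => integral_nonneg fun _ => sq_nonneg _
  have hR0 : 0 ≤ R := mul_nonneg hτ (sub_nonneg.2 (hs.sum_le_tsum I fun j _ => h0 j))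
  have hDm : AEStronglyMeasurable D P :=
    hD.aestronglyMeasurable fun K => (h.memLp_sum K).1
  have hconv : TendstoInMeasure P
      (fun (K : Finset J) ω => ∑ j ∈ K, ξ j ω • φ j ω - ∑ j ∈ I, ξ j ω • φ j ω) atTop
      (fun ω => D ω - ∑ j ∈ I, ξ j ω • φ j ω) := by
    rw [tendstoInMeasure_iff_norm] at hD ⊢
    simpa only [sub_sub_sub_cancel_right] using hD
  have hle : eLpNorm (fun ω => D ω - ∑ j ∈ I, ξ j ω • φ j ω) 2 P ≤ ENNReal.ofReal (√R) := by
    refine eLpNorm_le_of_tendstoInMeasure ?_ hconv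
      fun K => ((h.memLp_sum K).sub (h.memLp_sum I)).1
    filter_upwards [eventually_ge_atTop I] with K hK
    have hdiff : (fun ω => ∑ j ∈ K, ξ j ω • φ j ω - ∑ j ∈ I, ξ j ω • φ j ω)
        = fun ω => ∑ j ∈ K \ I, ξ j ω • φ j ω := by
      funext ω
      rw [← Finset.sum_sdiff hK, add_sub_cancel_right]
    rw [hdiff, eLpNorm_two_eq_ofReal_sqrt (h.memLp_sum _), h.integral_norm_sq_sum]
    refine ENNReal.ofReal_le_ofReal (Real.sqrt_le_sqrt (mul_le_mul_of_nonneg_left ?_ hτ))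
    rw [le_sub_iff_add_le, Finset.sum_sdiff hK]
    exact hs.sum_le_tsum K fun j _ => h0 j
  have hmem : MemLp (fun ω => D ω - ∑ j ∈ I, ξ j ω • φ j ω) 2 P :=
    ⟨hDm.sub (h.memLp_sum I).1, hle.trans_lt ENNReal.ofReal_lt_top⟩
  refine ⟨hmem, ?_⟩
  rw [eLpNorm_two_eq_ofReal_sqrt hmem, ENNReal.ofReal_le_ofReal_iff (Real.sqrt_nonneg _)] at hle
  exact (Real.sqrt_le_sqrt_iff hR0).1 hle

theorem memLp_limit (h : IsNoiseFamily P m₁ m₂ τ ξ φ) (hτ : 0 ≤ τ)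
    (hs : Summable fun j => ∫ ω, ‖φ j ω‖ ^ 2 ∂P)
    (hD : TendstoInMeasure P (fun (I : Finset J) ω => ∑ j ∈ I, ξ j ω • φ j ω) atTop D) :
    MemLp D 2 P := by
  simpa using (h.memLp_sub_and_integral_le hτ hs hD ∅).1

theorem integral_norm_sq_limit_le (h : IsNoiseFamily P m₁ m₂ τ ξ φ) (hτ : 0 ≤ τ)
    (hs : Summable fun j => ∫ ω, ‖φ j ω‖ ^ 2 ∂P)
    (hD : TendstoInMeasure P (fun (I : Finset J) ω => ∑ j ∈ I, ξ j ω • φ j ω) atTop D) :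
    ∫ ω, ‖D ω‖ ^ 2 ∂P ≤ τ * ∑' j, ∫ ω, ‖φ j ω‖ ^ 2 ∂P := by
  simpa using (h.memLp_sub_and_integral_le hτ hs hD ∅).2

theorem integral_inner_limit (h : IsNoiseFamily P m₁ m₂ τ ξ φ) (hτ : 0 ≤ τ)
    (hs : Summable fun j => ∫ ω, ‖φ j ω‖ ^ 2 ∂P)
    (hD : TendstoInMeasure P (fun (I : Finset J) ω => ∑ j ∈ I, ξ j ω • φ j ω) atTop D)
    {Y : Ω → H} (hY : AEStronglyMeasurable[m₂] Y P) (hY2 : MemLp Y 2 P) :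
    ∫ ω, inner ℝ (D ω) (Y ω) ∂P = 0 := by
  have hDL := h.memLp_limit hτ hs hD
  set a := ∫ ω, inner ℝ (D ω) (Y ω) ∂P with ha
  set y := ∫ ω, ‖Y ω‖ ^ 2 ∂P with hy
  have hy0 : 0 ≤ y := integral_nonneg fun _ => sq_nonneg _
  have key : ∀ b : ℝ, 2 * (b * a) ≤ b ^ 2 * y := by
    intro b
    have hbY : MemLp (fun ω => b • Y ω) 2 P := hY2.const_smul b
    have hlim : Tendsto (fun I : Finset J =>
        τ * (∑' j, ∫ ω, ‖φ j ω‖ ^ 2 ∂P - ∑ j ∈ I, ∫ ω, ‖φ j ω‖ ^ 2 ∂P) + b ^ 2 * y) atTop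
        (𝓝 (b ^ 2 * y)) := by
      have h1 := ((hs.hasSum.const_sub (∑' j, ∫ ω, ‖φ j ω‖ ^ 2 ∂P)).const_mul τ).add_const
        (b ^ 2 * y)
      rwa [sub_self, mul_zero, zero_add] at h1
    refine ge_of_tendsto' hlim fun I => ?_
    obtain ⟨hm, hle⟩ := h.memLp_sub_and_integral_le hτ hs hD I
    have h1 := two_mul_integral_inner_le hm hbY one_pos
    have h2 : ∫ ω, inner ℝ (D ω - ∑ j ∈ I, ξ j ω • φ j ω) (b • Y ω) ∂P = b * a := by
      simp only [real_inner_smul_right]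
      rw [integral_const_mul]
      simp only [inner_sub_left]
      rw [ integral_sub (integrable_inner_of_memLp_two hDL hY2)
        (integrable_inner_of_memLp_two (h.memLp_sum I) hY2), h.integral_inner_sum I hY hY2, sub_zero]
    have h3 : ∫ ω, ‖b • Y ω‖ ^ 2 ∂P = b ^ 2 * y := by
      simp only [norm_smul, mul_pow, Real.norm_eq_abs, sq_abs]
      rw [integral_const_mul]
    rw [h2, h3, inv_one, one_mul, one_mul] at h1
    linarith
  -- the quadratic inequality at `b = a / (y + 1)` reads `a² (y + 2) ≤ 0`
  have h1 := key (a / (y + 1))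
  have hy1 : 0 < y + 1 := by linarith
  have h2 : 2 * (a / (y + 1) * a) = 2 * a ^ 2 * (y + 1) / (y + 1) ^ 2 := by field_simp
  have h3 : (a / (y + 1)) ^ 2 * y = a ^ 2 * y / (y + 1) ^ 2 := by field_simp
  rw [h2, h3, div_le_div_iff_of_pos_right (by positivity)] at h1
  have h4 : 0 ≤ a ^ 2 * y := by positivity
  exact pow_eq_zero_iff two_ne_zero |>.1 (le_antisymm (by nlinarith) (sq_nonneg a))

theorem aestronglyMeasurable_limit (h : IsNoiseFamily P m₁ m₂ τ ξ φ)
    (hnull : ∀ s : Set Ω, P s = 0 → MeasurableSet[m₃] s)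
    (hξ : ∀ j, Measurable[m₃] (ξ j)) (hm₂ : m₂ ≤ m₃)
    (hD : TendstoInMeasure P (fun (I : Finset J) ω => ∑ j ∈ I, ξ j ω • φ j ω) atTop D) :
    AEStronglyMeasurable[m₃] D P := by
  obtain ⟨ns, -, hns⟩ := hD.exists_seq_tendsto_ae'
  set G := {ω | Tendsto (fun i => ∑ j ∈ ns i, ξ j ω • φ j ω) atTop (𝓝 (D ω))} with hG
  have hGm : MeasurableSet[m₃] G := MeasurableSet.of_compl (m := m₃) (hnull Gᶜ hns)
  refine ⟨G.indicator D, ?_, ?_⟩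
  · have hm : ∀ i, StronglyMeasurable[m₃] (G.indicator fun ω => ∑ j ∈ ns i, ξ j ω • φ j ω) :=
      fun i => (Finset.stronglyMeasurable_fun_sum _ fun j _ =>
        (hξ j).stronglyMeasurable.smul ((h.measurable_vec j).mono hm₂)).indicator hGm
    refine stronglyMeasurable_of_tendsto (m := m₃) atTop hm (tendsto_pi_nhds.2 fun ω => ?_)
    by_cases hω : ω ∈ G
    · simp only [Set.indicator_of_mem hω]
      exact hω
    · simp only [Set.indicator_of_notMem hω]
      exact tendsto_const_nhds
  · filter_upwards [hns] with ω hω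
    exact (Set.indicator_of_mem (s := G) hω D).symm

end IsNoiseFamily

end NoiseSeries

/-! ### Increments of the Wiener process -/

section WienerIncrement

variable {U H Ω : Type*} [NormedAddCommGroup U] [InnerProductSpace ℝ U]
  [NormedAddCommGroup H] [InnerProductSpace ℝ H]
  {m : MeasurableSpace Ω} {T : ℝ} {P : Measure Ω}
  {F : Filtration (Set.Icc (0 : ℝ) T) m} {Q S : U →L[ℝ] U} {W : Set.Icc (0 : ℝ) T → U → Ω → ℝ}

/-- The pseudo-inverse of `S` maps `Q u = S (S u)` to `S u`, because the range of the symmetric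
operator `S` is orthogonal to its kernel. -/
theorem CameronMartin.pinv_eq_of_toU_eq [CompleteSpace U] (hS : S.IsPositive) (hSQ : S ∘L S = Q)
    {e : CameronMartin S} {u : U} (h : toU S e = Q u) : pinv S e = S u := by
  have hmem : S u ∈ (LinearMap.ker (S : U →ₗ[ℝ] U))ᗮ := by
    intro x hx
    rw [← hS.inner_left_eq_inner_right, show S x = 0 from hx, inner_zero_left]
  have hker : pinv S e - S u ∈ LinearMap.ker (S : U →ₗ[ℝ] U) := by
    change S (pinv S e - S u) = 0
    rw [map_sub, apply_pinv, h, ← hSQ, ContinuousLinearMap.comp_apply, sub_self]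
  exact sub_eq_zero.1 ((Submodule.disjoint_def.1 (isCompl_ker S).disjoint) _
    (Submodule.sub_mem _ (pinv_mem S e) hmem) hker)

theorem CameronMartin.inner_apply_eq_inner [CompleteSpace U] (hS : S.IsPositive)
    (hSQ : S ∘L S = Q) {e f : CameronMartin S} {u v : U} (hu : toU S e = Q u)
    (hv : toU S f = Q v) : inner ℝ (Q u) v = inner ℝ e f := by
  have h : inner ℝ e f = inner ℝ (pinv S e) (pinv S f) := rfl
  rw [h, pinv_eq_of_toU_eq hS hSQ hu, pinv_eq_of_toU_eq hS hSQ hv, ← hSQ,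
    ContinuousLinearMap.comp_apply, hS.inner_left_eq_inner_right]

namespace IsWienerProcess

variable {s t : Set.Icc (0 : ℝ) T}

theorem measurable_increment (hW : IsWienerProcess P F Q W) (hst : s ≤ t) (u : U) :
    Measurable[F t] fun ω => W t u ω - W s u ω :=
  (hW.adapted t u).sub ((hW.adapted s u).mono (F.mono hst) le_rfl)

theorem memLp_increment (hW : IsWienerProcess P F Q W) (hst : s ≤ t) (u : U) :
    MemLp (fun ω => W t u ω - W s u ω) 2 P := by
  have hm : AEMeasurable (fun ω => W t u ω - W s u ω) P :=
    ((hW.measurable_increment hst u).mono (F.le t) le_rfl).aemeasurable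
  have h := memLp_id_gaussianReal (μ := 0) (v := (((t : ℝ) - s) * inner ℝ (Q u) u).toNNReal) 2
  rw [← hW.gaussian s t hst u] at h
  exact (memLp_map_measure_iff aestronglyMeasurable_id hm).1 h

theorem integral_increment (hW : IsWienerProcess P F Q W) (hst : s ≤ t) (u : U) :
    ∫ ω, (W t u ω - W s u ω) ∂P = 0 := by
  have hm : AEMeasurable (fun ω => W t u ω - W s u ω) P :=
    ((hW.measurable_increment hst u).mono (F.le t) le_rfl).aemeasurable
  have h := integral_map hm (aestronglyMeasurable_id (μ := P.map fun ω => W t u ω - W s u ω))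
  rw [hW.gaussian s t hst u] at h
  exact h.symm.trans integral_id_gaussianReal

theorem integral_increment_sq (hW : IsWienerProcess P F Q W) (hQ : Q.IsPositive) (hst : s ≤ t)
    (u : U) : ∫ ω, (W t u ω - W s u ω) ^ 2 ∂P = ((t : ℝ) - s) * inner ℝ (Q u) u := by
  have hm : AEMeasurable (fun ω => W t u ω - W s u ω) P :=
    ((hW.measurable_increment hst u).mono (F.le t) le_rfl).aemeasurable
  have hq : 0 ≤ ((t : ℝ) - s) * inner ℝ (Q u) u :=
    mul_nonneg (sub_nonneg.2 hst) (hQ.inner_nonneg_left u)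
  have h := variance_id_gaussianReal (μ := 0) (v := (((t : ℝ) - s) * inner ℝ (Q u) u).toNNReal)
  rw [variance_eq_integral aemeasurable_id] at h
  simp only [id_eq, integral_id_gaussianReal, sub_zero, Real.coe_toNNReal _ hq] at h
  rw [← h, ← hW.gaussian s t hst u, integral_map hm (by fun_prop)]

theorem integral_increment_mul (hW : IsWienerProcess P F Q W) (hQ : Q.IsPositive) (hst : s ≤ t)
    (u v : U) : ∫ ω, (W t u ω - W s u ω) * (W t v ω - W s v ω) ∂P
      = ((t : ℝ) - s) * inner ℝ (Q u) v := by
  have hu := hW.memLp_increment hst u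
  have hv := hW.memLp_increment hst v
  have hsum := hW.integral_increment_sq hQ hst (u + v)
  have hexp : ∫ ω, (W t (u + v) ω - W s (u + v) ω) ^ 2 ∂P
      = ∫ ω, ((W t u ω - W s u ω) ^ 2 + (W t v ω - W s v ω) ^ 2
          + 2 * ((W t u ω - W s u ω) * (W t v ω - W s v ω))) ∂P := by
    refine integral_congr_ae ?_
    filter_upwards [hW.linear t 1 1 u v, hW.linear s 1 1 u v] with ω ht hs
    simp only [one_smul, one_mul] at ht hs
    rw [ht, hs]
    ring
  have hmul : Integrable (fun ω => (W t u ω - W s u ω) * (W t v ω - W s v ω)) P :=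
    hu.integrable_mul hv
  have hsq : Integrable (fun ω => (W t u ω - W s u ω) ^ 2 + (W t v ω - W s v ω) ^ 2) P :=
    hu.integrable_sq.add hv.integrable_sq
  rw [hexp, integral_add hsq (hmul.const_mul 2), integral_add hu.integrable_sq hv.integrable_sq, integral_const_mul,
    hW.integral_increment_sq hQ hst, hW.integral_increment_sq hQ hst, map_add, inner_add_left,
    inner_add_right, inner_add_right, hQ.inner_left_eq_inner_right v u,
    real_inner_comm (Q u) v] at hsum
  linarith

end IsWienerProcess

theorem HilbertSchmidt.norm_apply_le [CompleteSpace U] [CompleteSpace H] {J : Type*}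
    (e : HilbertBasis J ℝ U) (j : J) (L : HilbertSchmidt U H) : ‖L (e j)‖ ≤ ‖L‖ := by
  have h := le_hasSum (hasSum_sq e L) j fun i _ => sq_nonneg _
  exact (pow_le_pow_iff_left₀ (norm_nonneg _) (norm_nonneg _) two_ne_zero).1 h

theorem HilbertSchmidt.continuous_apply [CompleteSpace U] [CompleteSpace H] {J : Type*}
    (e : HilbertBasis J ℝ U) (j : J) : Continuous fun L : HilbertSchmidt U H => L (e j) := by
  let f : HilbertSchmidt U H →ₗ[ℝ] H :=
    (ContinuousLinearMap.apply ℝ H (e j)).toLinearMap ∘ₗ toCLM U H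
  exact (f.mkContinuous 1 fun L => (norm_apply_le e j L).trans_eq (one_mul _).symm).continuous

namespace IsNoiseIncrement

variable [CompleteSpace U]
  {Φ : Ω → HilbertSchmidt (CameronMartin S) H} {s t : Set.Icc (0 : ℝ) T} {D : Ω → H}

theorem congr {Φ' : Ω → HilbertSchmidt (CameronMartin S) H} (hΦ : Φ =ᵐ[P] Φ')
    (hD : IsNoiseIncrement P Q S W Φ s t D) : IsNoiseIncrement P Q S W Φ' s t D := by
  obtain ⟨J, hJ, e, u, heu, hlim⟩ := hD
  refine ⟨J, hJ, e, u, heu, hlim.congr_left fun I => ?_⟩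
  filter_upwards [hΦ] with ω hω
  rw [hω]

variable [CompleteSpace H] [TopologicalSpace.SeparableSpace H]

/-- Along the basis of `U₀` in the definition of `Φ (W(t) - W(s))` the coefficients of the noise
are uncorrelated, and they are independent of `F s`. -/
theorem exists_isNoiseFamily (hW : IsWienerProcess P F Q W) (hQ : Q.IsPositive)
    (hS : S.IsPositive) (hSQ : S ∘L S = Q) (hst : s ≤ t) (hΦ : Measurable[F s] Φ)
    (hΦ2 : Integrable (fun ω => ‖Φ ω‖ ^ 2) P) (hD : IsNoiseIncrement P Q S W Φ s t D) :
    ∃ (J : Type) (_ : Countable J) (m₁ : MeasurableSpace Ω) (ξ : J → Ω → ℝ) (φ : J → Ω → H),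
      IsNoiseFamily P m₁ (F s) ((t : ℝ) - s) ξ φ ∧ (∀ j, Measurable[F t] (ξ j)) ∧
      (Summable fun j => ∫ ω, ‖φ j ω‖ ^ 2 ∂P) ∧
      ∑' j, ∫ ω, ‖φ j ω‖ ^ 2 ∂P ≤ ∫ ω, ‖Φ ω‖ ^ 2 ∂P ∧
      TendstoInMeasure P (fun (I : Finset J) ω => ∑ j ∈ I, ξ j ω • φ j ω) atTop D := by
  obtain ⟨J, hJ, e, u, heu, hlim⟩ := hD
  have hcov : ∀ i j, inner ℝ (Q (u i)) (u j) = inner ℝ (e i) (e j) := fun i j =>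
    CameronMartin.inner_apply_eq_inner hS hSQ (heu i) (heu j)
  have hvec : ∀ j, StronglyMeasurable[F s] fun ω => Φ ω (e j) := by
    intro j
    borelize H
    have := UniformSpace.secondCountable_of_separable H
    exact ((HilbertSchmidt.continuous_apply e j).measurable.comp hΦ).stronglyMeasurable
  have hvec2 : ∀ j, MemLp (fun ω => Φ ω (e j)) 2 P := by
    intro j
    have hm := ((hvec j).mono (F.le s)).aestronglyMeasurable (μ := P)
    refine (memLp_two_iff_integrable_sq_norm hm).2 (hΦ2.mono' (hm.norm.pow 2) ?_)
    refine ae_of_all _ fun ω => ?_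
    rw [Real.norm_of_nonneg (sq_nonneg _)]
    exact pow_le_pow_left₀ (norm_nonneg _) (HilbertSchmidt.norm_apply_le e j (Φ ω)) 2
  have hsum : ∀ I : Finset J, ∑ j ∈ I, ∫ ω, ‖Φ ω (e j)‖ ^ 2 ∂P ≤ ∫ ω, ‖Φ ω‖ ^ 2 ∂P := by
    intro I
    rw [← integral_finsetSum _ fun j _ => integrable_sq_norm_of_memLp_two (hvec2 j)]
    exact integral_mono
      (integrable_finsetSum _ fun j _ => integrable_sq_norm_of_memLp_two (hvec2 j)) hΦ2
      fun ω => sum_le_hasSum I (fun _ _ => sq_nonneg _) (HilbertSchmidt.hasSum_sq e (Φ ω))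
  have h0 : ∀ j, 0 ≤ ∫ ω, ‖Φ ω (e j)‖ ^ 2 ∂P := fun j => integral_nonneg fun _ => sq_nonneg _
  have hsummable : Summable fun j => ∫ ω, ‖Φ ω (e j)‖ ^ 2 ∂P := summable_of_sum_le h0 hsum
  refine ⟨J, hJ, _, fun j ω => W t (u j) ω - W s (u j) ω, fun j ω => Φ ω (e j),
    ⟨?_, F.le s, hW.indep s t hst, ?_, ?_, ?_, ?_, ?_, hvec, hvec2⟩, ?_, hsummable,
    hsummable.tsum_le_of_sum_le hsum, hlim⟩
  · exact iSup_le fun v => ((hW.measurable_increment hst v).mono (F.le t) le_rfl).comap_le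
  · exact fun j => Measurable.mono (comap_measurable _)
      (le_iSup (fun v => MeasurableSpace.comap (fun ω => W t v ω - W s v ω) inferInstance) (u j))
      le_rfl
  · exact fun j => hW.memLp_increment hst (u j)
  · exact fun j => hW.integral_increment hst (u j)
  · intro j
    rw [hW.integral_increment_mul hQ hst, hcov, real_inner_self_eq_norm_sq,
      e.orthonormal.norm_eq_one]
    ring
  · intro i j hij
    rw [hW.integral_increment_mul hQ hst, hcov, e.orthonormal.inner_eq_zero hij, mul_zero]
  · exact fun j => hW.measurable_increment hst (u j)

/-- The properties of the Itô integral of a constant integrand that the energy estimate uses: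
square integrability, the bound that comes from the Itô isometry, orthogonality to the past, and
adaptedness. -/
theorem properties (hW : IsWienerProcess P F Q W)
    (hnull : ∀ s : Set Ω, P s = 0 → MeasurableSet[F t] s)
    (hQ : Q.IsPositive) (hS : S.IsPositive) (hSQ : S ∘L S = Q) (hst : s ≤ t)
    (hΦ : Measurable[F s] Φ) (hΦ2 : Integrable (fun ω => ‖Φ ω‖ ^ 2) P)
    (hD : IsNoiseIncrement P Q S W Φ s t D) :
    MemLp D 2 P ∧ ∫ ω, ‖D ω‖ ^ 2 ∂P ≤ ((t : ℝ) - s) * ∫ ω, ‖Φ ω‖ ^ 2 ∂P ∧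
      (∀ Y : Ω → H, AEStronglyMeasurable[F s] Y P → MemLp Y 2 P →
        ∫ ω, inner ℝ (D ω) (Y ω) ∂P = 0) ∧
      AEStronglyMeasurable[F t] D P := by
  obtain ⟨J, hJ, m₁, ξ, φ, h, hξ, hs, hle, hlim⟩ :=
    hD.exists_isNoiseFamily hW hQ hS hSQ hst hΦ hΦ2
  have hτ : 0 ≤ (t : ℝ) - s := sub_nonneg.2 hst
  exact ⟨h.memLp_limit hτ hs hlim,
    (h.integral_norm_sq_limit_le hτ hs hlim).trans (mul_le_mul_of_nonneg_left hle hτ),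
    fun Y hY hY2 => h.integral_inner_limit hτ hs hlim hY hY2,
    h.aestronglyMeasurable_limit hnull hξ (F.mono hst) hlim⟩

end IsNoiseIncrement

end WienerIncrement

/-! ### The discrete energy inequality -/

/-- Telescoping of the integrated energy inequality. The sequences stand for `x n = E‖X n‖²`,
`z n = E‖2 X n - X (n - 1)‖²`, `δ n = E‖X n - 2 X (n - 1) + X (n - 2)‖²`, `b n = E‖B (X n)‖²`,
`q n = E‖X n‖_V ^ p` and `r n = E(D n, X n)` with the noise increment `D n`. -/
theorem sum_energy_le {x z δ b q r : ℕ → ℝ} {k κ c μ ν T : ℝ} {N : ℕ}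
    (hk : 0 ≤ k) (hc : 0 ≤ c) (hν : 1 ≤ ν) (hkN : k * N = T) (hb : ∀ n, 0 ≤ b n)
    (hstep : ∀ n, n + 2 ≤ N →
      x (n + 2) - x (n + 1) + z (n + 2) - z (n + 1) + δ (n + 2) + 2 * k * ν * b (n + 2)
        + 2 * k * μ * q (n + 2) - 2 * k * c - 2 * k * κ * x (n + 2)
      ≤ ν * (k * b (n + 1) + k * b n) + ν⁻¹ * δ (n + 2) + 4 * r (n + 2) - 4 * r (n + 1))
    (hr : ∀ n, n + 1 ≤ N → 4 * r (n + 1) ≤ k * b n + z (n + 1))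
    (hr1 : -(4 * r 1) ≤ k * b 0 + z 1) (hz1 : z 1 ≤ 5 * (x 0 + x 1)) (hx0 : 0 ≤ x 0)
    (M : ℕ) (hM : M + 1 ≤ N) :
    x (M + 1) + 2 * k * ν * b (M + 1) + 2 * k * μ * ∑ n ∈ Finset.Icc 2 (M + 1), q n
        + (1 - ν⁻¹) * ∑ n ∈ Finset.Icc 2 (M + 1), δ n
      ≤ 11 * (x 0 + x 1) + 2 * ν * (k * (b 0 + b 1)) + 2 * c * T
        + 2 * k * κ * ∑ n ∈ Finset.Icc 2 (M + 1), x n := by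
  have inv : ∀ M, M + 1 ≤ N →
      x (M + 1) + z (M + 1) - 4 * r (M + 1) + 2 * k * ν * b (M + 1) + k * ν * b M
        + (1 - ν⁻¹) * ∑ n ∈ Finset.Icc 2 (M + 1), δ n
        + 2 * k * μ * ∑ n ∈ Finset.Icc 2 (M + 1), q n
        - 2 * k * κ * ∑ n ∈ Finset.Icc 2 (M + 1), x n - 2 * k * c * M
      ≤ x 1 + z 1 - 4 * r 1 + 2 * k * ν * b 1 + k * ν * b 0 := by
    intro M
    induction M with
    | zero => intro _; simp
    | succ M ih =>
      intro hM
      have h1 := ih (by omega)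
      have h2 := hstep M hM
      have hsum : ∀ f : ℕ → ℝ, ∑ n ∈ Finset.Icc 2 (M + 1 + 1), f n
          = ∑ n ∈ Finset.Icc 2 (M + 1), f n + f (M + 2) := fun f =>
        Finset.sum_Icc_succ_top (by omega) f
      rw [hsum, hsum, hsum]
      push_cast
      linarith
  have h := inv M hM
  have hrM := hr M hM
  have hkb : ∀ n, k * b n ≤ k * ν * b n := fun n => by
    have := mul_nonneg hk (hb n)
    nlinarith
  have hkM : 2 * k * c * M ≤ 2 * c * T := by
    have : (M : ℝ) ≤ N := by exact_mod_cast (by omega : M ≤ N)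
    rw [← hkN]
    nlinarith [mul_nonneg hk hc]
  have h1 := hkb M
  have h2 := hkb 0
  nlinarith

/-- A discrete Gronwall inequality with the implicit term on the right-hand side. -/
theorem add_sum_le_mul_exp {x : ℕ → ℝ} {R a : ℝ} {N : ℕ} (ha0 : 0 ≤ a) (ha1 : a < 1) (hR : 0 ≤ R)
    (hx : ∀ M, M + 1 ≤ N → x (M + 1) ≤ R + a * ∑ n ∈ Finset.Icc 2 (M + 1), x n)
    (M : ℕ) (hM : M + 1 ≤ N) :
    R + a * ∑ n ∈ Finset.Icc 2 (M + 1), x n ≤ R * Real.exp (M * (a * (1 - a)⁻¹)) := by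
  have h1a : 0 < 1 - a := sub_pos.2 ha1
  induction M with
  | zero => simp
  | succ M ih =>
    have hS := ih (by omega)
    have hxM := hx (M + 1) hM
    rw [Finset.sum_Icc_succ_top (by omega)] at hxM ⊢
    set s := R + a * ∑ n ∈ Finset.Icc 2 (M + 1), x n with hs
    have h1 : x (M + 1 + 1) ≤ (1 - a)⁻¹ * s := by
      rw [le_inv_mul_iff₀ h1a]
      linarith
    have h2 : 1 + a * (1 - a)⁻¹ ≤ Real.exp (a * (1 - a)⁻¹) := by
      rw [add_comm]
      exact Real.add_one_le_exp _
    have h3 : 1 + a * (1 - a)⁻¹ = (1 - a)⁻¹ := by field_simp; ring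
    have h4 : 0 ≤ R * Real.exp (M * (a * (1 - a)⁻¹)) := by positivity
    calc R + a * (∑ n ∈ Finset.Icc 2 (M + 1), x n + x (M + 1 + 1))
        = s + a * x (M + 1 + 1) := by rw [hs]; ring
      _ ≤ s + a * ((1 - a)⁻¹ * s) := by gcongr
      _ = (1 + a * (1 - a)⁻¹) * s := by ring
      _ ≤ (1 + a * (1 - a)⁻¹) * (R * Real.exp (M * (a * (1 - a)⁻¹))) := by
          refine mul_le_mul_of_nonneg_left hS ?_
          rw [h3]; positivity
      _ ≤ Real.exp (a * (1 - a)⁻¹) * (R * Real.exp (M * (a * (1 - a)⁻¹))) := by gcongr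
      _ = R * Real.exp ((M + 1 : ℕ) * (a * (1 - a)⁻¹)) := by
          rw [Nat.cast_succ, add_mul, Real.exp_add, one_mul]; ring

/-! ### The energy identity of the BDF2 scheme -/

section Hilbert

variable {H : Type*} [NormedAddCommGroup H] [InnerProductSpace ℝ H]

/-- The `G`-stability identity of the two-step backward difference formula. -/
theorem four_mul_inner_bdf2 (x y z : H) :
    4 * inner ℝ ((3 / 2 : ℝ) • x - (2 : ℝ) • y + (1 / 2 : ℝ) • z) x
      = ‖x‖ ^ 2 - ‖y‖ ^ 2 + ‖(2 : ℝ) • x - y‖ ^ 2 - ‖(2 : ℝ) • y - z‖ ^ 2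
        + ‖x - (2 : ℝ) • y + z‖ ^ 2 := by
  simp only [← real_inner_self_eq_norm_sq, inner_add_left, inner_sub_left, inner_add_right,
    inner_sub_right, real_inner_smul_left, real_inner_smul_right, real_inner_comm x y,
    real_inner_comm x z, real_inner_comm y z]
  ring

/-- The splitting of the noise term. The third and the fourth summand are inner products of a noise
increment with a quantity from its past; the second and the last one telescope. -/
theorem inner_noise_eq (d e x y z : H) :
    inner ℝ ((6 : ℝ) • d - (2 : ℝ) • e) x
      = 2 * inner ℝ (d - e) (x - (2 : ℝ) • y + z) + 4 * inner ℝ d x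
        + 2 * inner ℝ d ((2 : ℝ) • y - z) + 2 * inner ℝ e z - 4 * inner ℝ e y := by
  simp only [inner_add_right, inner_sub_left, inner_sub_right, real_inner_smul_left,
    real_inner_smul_right]
  ring

theorem norm_sq_two_smul_sub_le (x y : H) :
    ‖(2 : ℝ) • x - y‖ ^ 2 ≤ 5 * (‖y‖ ^ 2 + ‖x‖ ^ 2) := by
  have h : 5 * (‖y‖ ^ 2 + ‖x‖ ^ 2) - ‖(2 : ℝ) • x - y‖ ^ 2 = ‖x + (2 : ℝ) • y‖ ^ 2 := by
    simp only [← real_inner_self_eq_norm_sq, inner_sub_left, inner_sub_right, inner_add_left,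
      inner_add_right, real_inner_smul_left, real_inner_smul_right, real_inner_comm x y]
    ring
  linarith [sq_nonneg ‖x + (2 : ℝ) • y‖]

end Hilbert

/-! ### Integration of the energy inequality -/

section HasMean

variable {Ω : Type*} {m : MeasurableSpace Ω} {P : Measure Ω}

/-- `f` is integrable with the integral `a`. -/
def HasMean (P : Measure Ω) (f : Ω → ℝ) (a : ℝ) : Prop := Integrable f P ∧ ∫ ω, f ω ∂P = a

namespace HasMean

variable {f g : Ω → ℝ} {a b : ℝ}

theorem of_integrable (hf : Integrable f P) : HasMean P f (∫ ω, f ω ∂P) := ⟨hf, rfl⟩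

theorem const [IsProbabilityMeasure P] (a : ℝ) : HasMean P (fun _ => a) a :=
  ⟨integrable_const a, by simp⟩

theorem add (hf : HasMean P f a) (hg : HasMean P g b) : HasMean P (fun ω => f ω + g ω) (a + b) :=
  ⟨hf.1.add hg.1, by rw [integral_add hf.1 hg.1, hf.2, hg.2]⟩

theorem sub (hf : HasMean P f a) (hg : HasMean P g b) : HasMean P (fun ω => f ω - g ω) (a - b) :=
  ⟨hf.1.sub hg.1, by rw [integral_sub hf.1 hg.1, hf.2, hg.2]⟩

theorem const_mul (hf : HasMean P f a) (c : ℝ) : HasMean P (fun ω => c * f ω) (c * a) :=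
  ⟨hf.1.const_mul c, by rw [integral_const_mul, hf.2]⟩

theorem le (hf : HasMean P f a) (hg : HasMean P g b) (h : ∀ᵐ ω ∂P, f ω ≤ g ω) : a ≤ b := by
  rw [← hf.2, ← hg.2]
  exact integral_mono_ae hf.1 hg.1 h

end HasMean

end HasMean

section Energy

variable {Ω H : Type*} {m : MeasurableSpace Ω} {P : Measure Ω}
  [NormedAddCommGroup H] [InnerProductSpace ℝ H]

/-- What remains of the BDF2-Maruyama scheme once it is tested with `X n` and the coercivity is
inserted. Here `β n` and `η n` stand for `‖B (X n)‖` and `‖X n‖_V ^ p`, and `D n` is the noise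
increment from step `n - 1` to step `n`, whose integrand has the norm `β (n - 1)`. The properties
of the increment are available only once its integrand is known to be square integrable. -/
structure IsEnergyScheme (P : Measure Ω) (G : ℕ → MeasurableSpace Ω) (X D : ℕ → Ω → H)
    (β η : ℕ → Ω → ℝ) (k κ c μ ν : ℝ) (N : ℕ) : Prop where
  mono : ∀ n, n + 1 ≤ N → G n ≤ G (n + 1)
  le : ∀ n, G n ≤ m
  adapted : ∀ n ≤ N, StronglyMeasurable[G n] (X n)
  measurable_β : ∀ n ≤ N, AEStronglyMeasurable (β n) P
  measurable_η : ∀ n ≤ N, AEStronglyMeasurable (η n) P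
  η_nonneg : ∀ n ω, 0 ≤ η n ω
  noise : ∀ n, n + 1 ≤ N → Integrable (fun ω => β n ω ^ 2) P →
    MemLp (D (n + 1)) 2 P ∧ ∫ ω, ‖D (n + 1) ω‖ ^ 2 ∂P ≤ k * ∫ ω, β n ω ^ 2 ∂P ∧
      (∀ Y : Ω → H, AEStronglyMeasurable[G n] Y P → MemLp Y 2 P →
        ∫ ω, inner ℝ (D (n + 1) ω) (Y ω) ∂P = 0) ∧
      AEStronglyMeasurable[G (n + 1)] (D (n + 1)) P
  energy : ∀ n, n + 2 ≤ N → ∀ᵐ ω ∂P,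
    4 * inner ℝ ((3 / 2 : ℝ) • X (n + 2) ω - (2 : ℝ) • X (n + 1) ω + (1 / 2 : ℝ) • X n ω)
          (X (n + 2) ω)
        + 2 * k * ν * β (n + 2) ω ^ 2 + 2 * k * μ * η (n + 2) ω - 2 * k * c
        - 2 * k * κ * ‖X (n + 2) ω‖ ^ 2
      ≤ inner ℝ ((6 : ℝ) • D (n + 2) ω - (2 : ℝ) • D (n + 1) ω) (X (n + 2) ω)

namespace IsEnergyScheme

variable {G : ℕ → MeasurableSpace Ω} {X D : ℕ → Ω → H} {β η : ℕ → Ω → ℝ} {k κ c μ ν T : ℝ} {N : ℕ}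

/-- One step of the scheme preserves square integrability: the energy inequality bounds the new
quantities pathwise by the old ones and the noise. -/
theorem integrable_succ [IsFiniteMeasure P] (h : IsEnergyScheme P G X D β η k κ c μ ν N)
    (hk : 0 < k) (hμ : 0 < μ) (hν : 1 ≤ ν) (hkκ : 2 * k * κ < 1) {n : ℕ}
    (hn : n + 2 ≤ N) (hX0 : MemLp (X n) 2 P) (hX1 : MemLp (X (n + 1)) 2 P)
    (hβ0 : Integrable (fun ω => β n ω ^ 2) P) (hβ1 : Integrable (fun ω => β (n + 1) ω ^ 2) P) :
    MemLp (X (n + 2)) 2 P ∧ Integrable (fun ω => β (n + 2) ω ^ 2) P ∧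
      Integrable (η (n + 2)) P := by
  have hD1 := (h.noise n (by omega) hβ0).1
  have hD2 := (h.noise (n + 1) hn hβ1).1
  set R : Ω → H := fun ω => (6 : ℝ) • D (n + 2) ω - (2 : ℝ) • D (n + 1) ω
    + ((8 : ℝ) • X (n + 1) ω - (2 : ℝ) • X n ω) with hRdef
  have hR : MemLp R 2 P :=
    ((hD2.const_smul (6 : ℝ)).sub (hD1.const_smul (2 : ℝ))).add
      ((hX1.const_smul (8 : ℝ)).sub (hX0.const_smul (2 : ℝ)))
  have hbound : Integrable (fun ω => 2 * k * c + ‖R ω‖ ^ 2) P :=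
    (integrable_const _).add (integrable_sq_norm_of_memLp_two hR)
  have hν0 : 0 < ν := by linarith
  have hle : ∀ᵐ ω ∂P, ‖X (n + 2) ω‖ ^ 2 + 2 * k * ν * β (n + 2) ω ^ 2
      + 2 * k * μ * η (n + 2) ω ≤ 2 * k * c + ‖R ω‖ ^ 2 := by
    filter_upwards [h.energy n hn] with ω hω
    have h1 : inner ℝ (R ω) (X (n + 2) ω)
        = inner ℝ ((6 : ℝ) • D (n + 2) ω - (2 : ℝ) • D (n + 1) ω) (X (n + 2) ω)
          - 4 * inner ℝ ((3 / 2 : ℝ) • X (n + 2) ω - (2 : ℝ) • X (n + 1) ω + (1 / 2 : ℝ) • X n ω)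
            (X (n + 2) ω) + 6 * ‖X (n + 2) ω‖ ^ 2 := by
      rw [hRdef, ← real_inner_self_eq_norm_sq]
      simp only [inner_add_left, inner_sub_left, real_inner_smul_left]
      ring
    have h2 := real_inner_le_norm (R ω) (X (n + 2) ω)
    have h3 : 2 * k * κ * ‖X (n + 2) ω‖ ^ 2 ≤ 1 * ‖X (n + 2) ω‖ ^ 2 :=
      mul_le_mul_of_nonneg_right hkκ.le (sq_nonneg _)
    -- `(R, X) ≤ ‖R‖² / 16 + 4 ‖X‖²` leaves one of the six copies of `‖X‖²`
    nlinarith [sq_nonneg (‖R ω‖ / 4 - 2 * ‖X (n + 2) ω‖), sq_nonneg ‖R ω‖]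
  have hX : Integrable (fun ω => ‖X (n + 2) ω‖ ^ 2) P := by
    refine hbound.mono' (((h.adapted _ hn).mono (h.le _)).norm.pow 2).aestronglyMeasurable ?_
    filter_upwards [hle] with ω hω
    rw [Real.norm_of_nonneg (sq_nonneg _)]
    have h1 : 0 ≤ 2 * k * ν * β (n + 2) ω ^ 2 := by positivity
    have h2 : 0 ≤ 2 * k * μ * η (n + 2) ω := mul_nonneg (by positivity) (h.η_nonneg _ _)
    linarith
  refine ⟨(memLp_two_iff_integrable_sq_norm
    ((h.adapted _ hn).mono (h.le _)).aestronglyMeasurable).2 hX, ?_, ?_⟩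
  · refine (hbound.const_mul (2 * k * ν)⁻¹).mono' ((h.measurable_β _ hn).pow 2) ?_
    filter_upwards [hle] with ω hω
    rw [Real.norm_of_nonneg (sq_nonneg _), le_inv_mul_iff₀ (by positivity)]
    have h2 : 0 ≤ 2 * k * μ * η (n + 2) ω := mul_nonneg (by positivity) (h.η_nonneg _ _)
    linarith [sq_nonneg ‖X (n + 2) ω‖]
  · refine (hbound.const_mul (2 * k * μ)⁻¹).mono' (h.measurable_η _ hn) ?_
    filter_upwards [hle] with ω hω
    rw [Real.norm_of_nonneg (h.η_nonneg _ _), le_inv_mul_iff₀ (by positivity)]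
    have h1 : 0 ≤ 2 * k * ν * β (n + 2) ω ^ 2 := by positivity
    linarith [sq_nonneg ‖X (n + 2) ω‖]

theorem memLp_and_integrable [IsFiniteMeasure P] (h : IsEnergyScheme P G X D β η k κ c μ ν N)
    (hk : 0 < k) (hμ : 0 < μ) (hν : 1 ≤ ν) (hkκ : 2 * k * κ < 1)
    (hX : ∀ n ≤ 1, MemLp (X n) 2 P) (hβ : ∀ n ≤ 1, Integrable (fun ω => β n ω ^ 2) P)
    (n : ℕ) (hn : n ≤ N) : MemLp (X n) 2 P ∧ Integrable (fun ω => β n ω ^ 2) P := by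
  induction n using Nat.twoStepInduction with
  | zero => exact ⟨hX 0 (by omega), hβ 0 (by omega)⟩
  | one => exact ⟨hX 1 le_rfl, hβ 1 le_rfl⟩
  | more n ih0 ih1 =>
    have h0 := ih0 (by omega)
    have h1 := ih1 (by omega)
    have h2 := h.integrable_succ hk hμ hν hkκ hn h0.1 h1.1 h0.2 h1.2
    exact ⟨h2.1, h2.2.1⟩

/-- The expected energy inequality. The noise contributes the telescoping terms `E(D n, X n)` and
the term `2 E(D (n + 2) - D (n + 1), X (n + 2) - 2 X (n + 1) + X n)`, which Young's inequality
splits with the weight `ν`. -/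
theorem integral_energy_le [IsProbabilityMeasure P]
    (h : IsEnergyScheme P G X D β η k κ c μ ν N) (hν : 1 ≤ ν) {n : ℕ}
    (hn : n + 2 ≤ N) (hX : ∀ i ≤ n + 2, MemLp (X i) 2 P)
    (hβ : ∀ i ≤ n + 2, Integrable (fun ω => β i ω ^ 2) P) (hη : Integrable (η (n + 2)) P) :
    ∫ ω, ‖X (n + 2) ω‖ ^ 2 ∂P - ∫ ω, ‖X (n + 1) ω‖ ^ 2 ∂P
        + ∫ ω, ‖(2 : ℝ) • X (n + 2) ω - X (n + 1) ω‖ ^ 2 ∂P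
        - ∫ ω, ‖(2 : ℝ) • X (n + 1) ω - X n ω‖ ^ 2 ∂P
        + ∫ ω, ‖X (n + 2) ω - (2 : ℝ) • X (n + 1) ω + X n ω‖ ^ 2 ∂P
        + 2 * k * ν * ∫ ω, β (n + 2) ω ^ 2 ∂P + 2 * k * μ * ∫ ω, η (n + 2) ω ∂P
        - 2 * k * c - 2 * k * κ * ∫ ω, ‖X (n + 2) ω‖ ^ 2 ∂P
      ≤ ν * (k * ∫ ω, β (n + 1) ω ^ 2 ∂P + k * ∫ ω, β n ω ^ 2 ∂P)
        + ν⁻¹ * ∫ ω, ‖X (n + 2) ω - (2 : ℝ) • X (n + 1) ω + X n ω‖ ^ 2 ∂P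
        + 4 * ∫ ω, inner ℝ (D (n + 2) ω) (X (n + 2) ω) ∂P
        - 4 * ∫ ω, inner ℝ (D (n + 1) ω) (X (n + 1) ω) ∂P := by
  have hX0 := hX n (by omega)
  have hX1 := hX (n + 1) (by omega)
  have hX2 := hX (n + 2) le_rfl
  obtain ⟨hD1, hD1le, hD1orth, hD1m⟩ := h.noise n (by omega) (hβ n (by omega))
  obtain ⟨hD2, hD2le, hD2orth, -⟩ := h.noise (n + 1) hn (hβ (n + 1) (by omega))
  have hXm0 := h.adapted n (by omega)
  have hXm1 := h.adapted (n + 1) (by omega)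
  have hz2 : MemLp (fun ω => (2 : ℝ) • X (n + 2) ω - X (n + 1) ω) 2 P :=
    (hX2.const_smul (2 : ℝ)).sub hX1
  have hz1 : MemLp (fun ω => (2 : ℝ) • X (n + 1) ω - X n ω) 2 P :=
    (hX1.const_smul (2 : ℝ)).sub hX0
  have hd : MemLp (fun ω => X (n + 2) ω - (2 : ℝ) • X (n + 1) ω + X n ω) 2 P :=
    (hX2.sub (hX1.const_smul (2 : ℝ))).add hX0
  have hDD : MemLp (fun ω => D (n + 2) ω - D (n + 1) ω) 2 P := hD2.sub hD1
  have horthz : ∫ ω, inner ℝ (D (n + 2) ω) ((2 : ℝ) • X (n + 1) ω - X n ω) ∂P = 0 :=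
    hD2orth _ ((hXm1.const_smul (2 : ℝ)).sub
      (hXm0.mono (h.mono n (by omega)))).aestronglyMeasurable hz1
  have horth0 : ∫ ω, inner ℝ (D (n + 1) ω) (X n ω) ∂P = 0 :=
    hD1orth _ hXm0.aestronglyMeasurable hX0
  have horthD : ∫ ω, inner ℝ (D (n + 2) ω) (D (n + 1) ω) ∂P = 0 := hD2orth _ hD1m hD1
  have hDDle : ∫ ω, ‖D (n + 2) ω - D (n + 1) ω‖ ^ 2 ∂P
      ≤ k * ∫ ω, β (n + 1) ω ^ 2 ∂P + k * ∫ ω, β n ω ^ 2 ∂P := by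
    have h1 : ∫ ω, ‖D (n + 2) ω - D (n + 1) ω‖ ^ 2 ∂P
        = ∫ ω, ‖D (n + 2) ω‖ ^ 2 ∂P - 2 * ∫ ω, inner ℝ (D (n + 2) ω) (D (n + 1) ω) ∂P
          + ∫ ω, ‖D (n + 1) ω‖ ^ 2 ∂P := by
      have hD := ((HasMean.of_integrable (integrable_sq_norm_of_memLp_two hD2)).sub
        ((HasMean.of_integrable (integrable_inner_of_memLp_two hD2 hD1)).const_mul 2)).add
        (HasMean.of_integrable (integrable_sq_norm_of_memLp_two hD1))
      rw [← hD.2]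
      exact integral_congr_ae (ae_of_all _ fun ω => norm_sub_sq_real _ _)
    rw [h1, horthD]
    linarith
  have hyoung := two_mul_integral_inner_le hDD hd (by linarith : 0 < ν)
  have hνDD := mul_le_mul_of_nonneg_left hDDle (by linarith : 0 ≤ ν)
  have sq : ∀ {f : Ω → H}, MemLp f 2 P → HasMean P (fun ω => ‖f ω‖ ^ 2) (∫ ω, ‖f ω‖ ^ 2 ∂P) :=
    fun hf => .of_integrable (integrable_sq_norm_of_memLp_two hf)
  have inn : ∀ {f g : Ω → H}, MemLp f 2 P → MemLp g 2 P →
      HasMean P (fun ω => inner ℝ (f ω) (g ω)) (∫ ω, inner ℝ (f ω) (g ω) ∂P) :=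
    fun hf hg => .of_integrable (integrable_inner_of_memLp_two hf hg)
  have hL := ((((((((sq hX2).sub (sq hX1)).add (sq hz2)).sub (sq hz1)).add (sq hd)).add
    ((HasMean.of_integrable (hβ (n + 2) le_rfl)).const_mul (2 * k * ν))).add
    ((HasMean.of_integrable hη).const_mul (2 * k * μ))).sub (HasMean.const (2 * k * c))).sub
    ((sq hX2).const_mul (2 * k * κ))
  have hR := (((((inn hDD hd).const_mul 2).add ((inn hD2 hX2).const_mul 4)).add
    ((inn hD2 hz1).const_mul 2)).add ((inn hD1 hX0).const_mul 2)).sub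
    ((inn hD1 hX1).const_mul 4)
  have hle := hL.le hR (by
    filter_upwards [h.energy n hn] with ω hω
    rwa [four_mul_inner_bdf2, inner_noise_eq _ _ _ (X (n + 1) ω) (X n ω)] at hω)
  have hz : ∫ ω, inner ℝ (D (n + 1 + 1) ω) ((2 : ℝ) • X (n + 1) ω - X n ω) ∂P = 0 := horthz
  rw [hz, horth0] at hle
  linarith

/-- `4 E(D n, X n) = 2 E(D n, 2 X n - X (n - 1))`, since `D n` is orthogonal to the past. -/
theorem abs_four_mul_integral_inner_le [IsProbabilityMeasure P]
    (h : IsEnergyScheme P G X D β η k κ c μ ν N) {n : ℕ}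
    (hn : n + 1 ≤ N) (hX0 : MemLp (X n) 2 P) (hX1 : MemLp (X (n + 1)) 2 P)
    (hβ : Integrable (fun ω => β n ω ^ 2) P) :
    |4 * ∫ ω, inner ℝ (D (n + 1) ω) (X (n + 1) ω) ∂P|
      ≤ k * ∫ ω, β n ω ^ 2 ∂P + ∫ ω, ‖(2 : ℝ) • X (n + 1) ω - X n ω‖ ^ 2 ∂P := by
  obtain ⟨hD, hDle, hDorth, -⟩ := h.noise n hn hβ
  have hz : MemLp (fun ω => (2 : ℝ) • X (n + 1) ω - X n ω) 2 P :=
    (hX1.const_smul (2 : ℝ)).sub hX0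
  have heq : ∫ ω, inner ℝ (D (n + 1) ω) ((2 : ℝ) • X (n + 1) ω - X n ω) ∂P
      = 2 * ∫ ω, inner ℝ (D (n + 1) ω) (X (n + 1) ω) ∂P := by
    have h1 := ((HasMean.of_integrable (integrable_inner_of_memLp_two hD hX1)).const_mul 2).sub
      (HasMean.of_integrable (integrable_inner_of_memLp_two hD hX0))
    rw [hDorth _ (h.adapted n (by omega)).aestronglyMeasurable hX0, sub_zero] at h1
    rw [← h1.2]
    refine integral_congr_ae (ae_of_all _ fun ω => ?_)
    simp only [inner_sub_right, real_inner_smul_right]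
  have hpos := two_mul_integral_inner_le hD hz one_pos
  have hneg := two_mul_integral_inner_le hD.neg hz one_pos
  simp only [Pi.neg_apply, inner_neg_left, integral_neg, norm_neg] at hneg
  rw [heq] at hpos hneg
  rw [abs_le]
  constructor <;> linarith

/-- The a priori estimate for the expectations. -/
theorem expectation_le [IsProbabilityMeasure P] (h : IsEnergyScheme P G X D β η k κ c μ ν N)
    (hk : 0 < k) (hκ : 0 ≤ κ) (hc : 0 ≤ c) (hμ : 0 < μ) (hν : 1 ≤ ν) (hkκ : 2 * k * κ < 1)
    (hkN : k * N = T) (hX : ∀ n ≤ 1, MemLp (X n) 2 P)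
    (hβ : ∀ n ≤ 1, Integrable (fun ω => β n ω ^ 2) P) (M : ℕ) (hM : M + 1 ≤ N) :
    ∫ ω, ‖X (M + 1) ω‖ ^ 2 ∂P + 2 * k * ν * ∫ ω, β (M + 1) ω ^ 2 ∂P
        + 2 * k * μ * ∑ n ∈ Finset.Icc 2 (M + 1), ∫ ω, η n ω ∂P
        + (1 - ν⁻¹) * ∑ n ∈ Finset.Icc 2 (M + 1),
            ∫ ω, ‖X n ω - (2 : ℝ) • X (n - 1) ω + X (n - 2) ω‖ ^ 2 ∂P
      ≤ max (2 * c) (max 11 (2 * ν)) * (1 - 2 * k * κ)⁻¹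
          * Real.exp (2 * κ * T * (1 - 2 * k * κ)⁻¹)
          * (T + (∫ ω, ‖X 0 ω‖ ^ 2 ∂P + ∫ ω, ‖X 1 ω‖ ^ 2 ∂P)
            + k * (∫ ω, β 0 ω ^ 2 ∂P + ∫ ω, β 1 ω ^ 2 ∂P)) := by
  have hint := h.memLp_and_integrable hk hμ hν hkκ hX hβ
  have hN : 1 ≤ N := by omega
  have hT : 0 ≤ T := by rw [← hkN]; positivity
  have hx0 : ∀ n, 0 ≤ ∫ ω, ‖X n ω‖ ^ 2 ∂P := fun n => integral_nonneg fun _ => sq_nonneg _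
  have hb0 : ∀ n, 0 ≤ ∫ ω, β n ω ^ 2 ∂P := fun n => integral_nonneg fun _ => sq_nonneg _
  have hq0 : ∀ n, 0 ≤ ∫ ω, η n ω ∂P := fun n => integral_nonneg fun ω => h.η_nonneg n ω
  have hν1 : 0 ≤ 1 - ν⁻¹ := sub_nonneg.2 (inv_le_one_of_one_le₀ hν)
  have hr : ∀ n, n + 1 ≤ N → |4 * ∫ ω, inner ℝ (D (n + 1) ω) (X (n + 1) ω) ∂P|
      ≤ k * ∫ ω, β n ω ^ 2 ∂P + ∫ ω, ‖(2 : ℝ) • X (n + 1) ω - X n ω‖ ^ 2 ∂P := fun n hn =>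
    h.abs_four_mul_integral_inner_le hn (hint n (by omega)).1 (hint (n + 1) hn).1
      (hint n (by omega)).2
  have hz1 : ∫ ω, ‖(2 : ℝ) • X 1 ω - X 0 ω‖ ^ 2 ∂P
      ≤ 5 * (∫ ω, ‖X 0 ω‖ ^ 2 ∂P + ∫ ω, ‖X 1 ω‖ ^ 2 ∂P) := by
    have h0 := HasMean.of_integrable (integrable_sq_norm_of_memLp_two (hX 0 zero_le_one))
    have h1 := HasMean.of_integrable (integrable_sq_norm_of_memLp_two (hX 1 le_rfl))
    have hz : MemLp (fun ω => (2 : ℝ) • X 1 ω - X 0 ω) 2 P :=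
      ((hX 1 le_rfl).const_smul (2 : ℝ)).sub (hX 0 zero_le_one)
    exact (HasMean.of_integrable (integrable_sq_norm_of_memLp_two hz)).le
      ((h0.add h1).const_mul 5) (ae_of_all _ fun ω => norm_sq_two_smul_sub_le _ _)
  set x : ℕ → ℝ := fun n => ∫ ω, ‖X n ω‖ ^ 2 ∂P with hx
  set b : ℕ → ℝ := fun n => ∫ ω, β n ω ^ 2 ∂P with hb
  set δ : ℕ → ℝ := fun n => ∫ ω, ‖X n ω - (2 : ℝ) • X (n - 1) ω + X (n - 2) ω‖ ^ 2 ∂P with hδ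
  set q : ℕ → ℝ := fun n => ∫ ω, η n ω ∂P with hq
  set K := max (2 * c) (max 11 (2 * ν)) with hK
  have hK1 : 2 * c ≤ K := le_max_left _ _
  have hK2 : 11 ≤ K := (le_max_left _ _).trans (le_max_right _ _)
  have hK3 : 2 * ν ≤ K := (le_max_right _ _).trans (le_max_right _ _)
  have hsum : ∀ M, M + 1 ≤ N →
      x (M + 1) + 2 * k * ν * b (M + 1) + 2 * k * μ * ∑ n ∈ Finset.Icc 2 (M + 1), q n
        + (1 - ν⁻¹) * ∑ n ∈ Finset.Icc 2 (M + 1), δ n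
      ≤ 11 * (x 0 + x 1) + 2 * ν * (k * (b 0 + b 1)) + 2 * c * T
        + 2 * k * κ * ∑ n ∈ Finset.Icc 2 (M + 1), x n := by
    refine sum_energy_le (z := fun n => ∫ ω, ‖(2 : ℝ) • X n ω - X (n - 1) ω‖ ^ 2 ∂P)
      (r := fun n => ∫ ω, inner ℝ (D n ω) (X n ω) ∂P) hk.le hc hν hkN hb0 ?_
      (fun n hn => (abs_le.1 (hr n hn)).2) ?_ hz1 (hx0 0)
    · intro n hn
      have h0 := hint n (by omega)
      have h1 := hint (n + 1) (by omega)
      exact h.integral_energy_le hν hn (fun i hi => (hint i (by omega)).1)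
        (fun i hi => (hint i (by omega)).2)
        (h.integrable_succ hk hμ hν hkκ hn h0.1 h1.1 h0.2 h1.2).2.2
    · have := (abs_le.1 (hr 0 hN)).1
      linarith
  set R := 11 * (x 0 + x 1) + 2 * ν * (k * (b 0 + b 1)) + 2 * c * T with hR
  have hR0 : 0 ≤ R := by
    have := hx0 0; have := hx0 1; have := hb0 0; have := hb0 1
    positivity
  have ha : 0 < 1 - 2 * k * κ := sub_pos.2 hkκ
  have hexp : R + 2 * k * κ * ∑ n ∈ Finset.Icc 2 (M + 1), x n
      ≤ R * Real.exp (M * (2 * k * κ * (1 - 2 * k * κ)⁻¹)) := by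
    refine add_sum_le_mul_exp (by positivity) hkκ hR0 (fun M hM => ?_) M hM
    refine le_trans ?_ (hsum M hM)
    have h1 : 0 ≤ 2 * k * ν * b (M + 1) := mul_nonneg (by positivity) (hb0 _)
    have h2 : 0 ≤ 2 * k * μ * ∑ n ∈ Finset.Icc 2 (M + 1), q n :=
      mul_nonneg (by positivity) (Finset.sum_nonneg fun n _ => hq0 n)
    have h3 : 0 ≤ (1 - ν⁻¹) * ∑ n ∈ Finset.Icc 2 (M + 1), δ n :=
      mul_nonneg hν1 (Finset.sum_nonneg fun n _ => integral_nonneg fun _ => sq_nonneg _)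
    linarith
  have hMT : M * (2 * k * κ * (1 - 2 * k * κ)⁻¹) ≤ 2 * κ * T * (1 - 2 * k * κ)⁻¹ := by
    have h1 : (M : ℝ) ≤ N := by exact_mod_cast (by omega : M ≤ N)
    have h2 : M * (2 * k * κ * (1 - 2 * k * κ)⁻¹) = 2 * κ * (k * M) * (1 - 2 * k * κ)⁻¹ := by ring
    rw [h2, ← hkN]
    gcongr
  have hRle : R ≤ K * (T + (x 0 + x 1) + k * (b 0 + b 1)) := by
    have h1 := mul_le_mul_of_nonneg_right hK2 (add_nonneg (hx0 0) (hx0 1))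
    have h2 := mul_le_mul_of_nonneg_right hK3 (mul_nonneg hk.le (add_nonneg (hb0 0) (hb0 1)))
    have h3 := mul_le_mul_of_nonneg_right hK1 hT
    calc R ≤ K * (x 0 + x 1) + K * (k * (b 0 + b 1)) + K * T := add_le_add (add_le_add h1 h2) h3
      _ = K * (T + (x 0 + x 1) + k * (b 0 + b 1)) := by ring
  have hinv : 1 ≤ (1 - 2 * k * κ)⁻¹ := by
    rw [one_le_inv₀ ha]
    have : 0 ≤ 2 * k * κ := by positivity
    linarith
  calc _ ≤ R * Real.exp (M * (2 * k * κ * (1 - 2 * k * κ)⁻¹)) := (hsum M hM).trans hexp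
    _ ≤ R * Real.exp (2 * κ * T * (1 - 2 * k * κ)⁻¹) := by gcongr
    _ ≤ (1 - 2 * k * κ)⁻¹ * (R * Real.exp (2 * κ * T * (1 - 2 * k * κ)⁻¹)) :=
        le_mul_of_one_le_left (by positivity) hinv
    _ ≤ (1 - 2 * k * κ)⁻¹ * (K * (T + (x 0 + x 1) + k * (b 0 + b 1))
          * Real.exp (2 * κ * T * (1 - 2 * k * κ)⁻¹)) := by gcongr
    _ = _ := by ring

end IsEnergyScheme

end Energy

/-! ### The scheme in the finite dimensional subspace -/

section Scheme

/-- An injective continuous map has a continuous linear left inverse on a finite dimensional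
subspace: project orthogonally onto the image and invert there. -/
theorem exists_continuousLinearMap_leftInverse {V H : Type*} [NormedAddCommGroup V]
    [NormedSpace ℝ V] [NormedAddCommGroup H] [InnerProductSpace ℝ H] {ι : V →L[ℝ] H}
    (hι : Function.Injective ι) (Vh : Submodule ℝ V) [FiniteDimensional ℝ Vh] :
    ∃ g : H →L[ℝ] V, (∀ x, g x ∈ Vh) ∧ ∀ v ∈ Vh, g (ι v) = v := by
  let f : Vh →ₗ[ℝ] H := (ι : V →ₗ[ℝ] H) ∘ₗ Vh.subtype
  have hf : Function.Injective f := hι.comp Subtype.val_injective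
  let e : Vh ≃ₗ[ℝ] LinearMap.range f := LinearEquiv.ofInjective f hf
  have : FiniteDimensional ℝ (LinearMap.range f) := inferInstance
  let e' : LinearMap.range f →L[ℝ] Vh := LinearMap.toContinuousLinearMap e.symm.toLinearMap
  refine ⟨Vh.subtypeL ∘L e' ∘L (LinearMap.range f).orthogonalProjectionOnto, fun x => ?_,
    fun v hv => ?_⟩
  · exact (e' _).2
  · have h1 : ι v = (e ⟨v, hv⟩ : H) := rfl
    change ((e' ((LinearMap.range f).orthogonalProjectionOnto (ι v)) : Vh) : V) = v
    rw [h1, Submodule.orthogonalProjectionOnto_mem_subspace_eq_self]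
    exact congrArg Subtype.val (e.symm_apply_apply ⟨v, hv⟩)

theorem coe_gridPoint {T : ℝ} (hT : 0 < T) {N n : ℕ} (hN : 0 < N) (hn : n ≤ N) :
    (gridPoint hT N n : ℝ) = n * (T / N) := by
  have hN' : (0 : ℝ) < N := by exact_mod_cast hN
  have hmem : (n : ℝ) * (T / N) ∈ Set.Icc 0 T := by
    refine ⟨by positivity, ?_⟩
    have h1 : (n : ℝ) ≤ N := by exact_mod_cast hn
    calc (n : ℝ) * (T / N) ≤ N * (T / N) := by gcongr
      _ = T := by field_simp
  rw [gridPoint, Set.projIcc_of_mem _ hmem]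

theorem gridPoint_mono {T : ℝ} (hT : 0 < T) (N : ℕ) : Monotone (gridPoint hT N) := by
  intro i j hij
  refine Set.monotone_projIcc _ ?_
  have h1 : (i : ℝ) ≤ j := by exact_mod_cast hij
  gcongr

variable {U V H Ω : Type*} [NormedAddCommGroup U] [InnerProductSpace ℝ U] [CompleteSpace U]
  [NormedAddCommGroup V] [NormedSpace ℝ V] [NormedAddCommGroup H] [InnerProductSpace ℝ H]
  {m : MeasurableSpace Ω} {T : ℝ}

/-- Two random functionals that agree almost surely on each element of a finite dimensional
subspace agree almost surely on the whole subspace, hence also on its random elements. -/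
theorem ae_forall_mem_of_forall_mem_ae {P : Measure Ω} (Vh : Submodule ℝ V)
    [FiniteDimensional ℝ Vh] {f g : Ω → V →ₗ[ℝ] ℝ} (h : ∀ v ∈ Vh, ∀ᵐ ω ∂P, f ω v = g ω v) :
    ∀ᵐ ω ∂P, ∀ v ∈ Vh, f ω v = g ω v := by
  let b := Module.finBasis ℝ Vh
  have hb : ∀ᵐ ω ∂P, ∀ i, f ω (b i) = g ω (b i) := ae_all_iff.2 fun i => h _ (b i).2
  filter_upwards [hb] with ω hω v hv
  have heq : f ω ∘ₗ Vh.subtype = g ω ∘ₗ Vh.subtype := b.ext hω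
  exact LinearMap.congr_fun heq ⟨v, hv⟩

/-- The operator `B` at a random element of `V` is as measurable as this element. -/
theorem OperatorAssumptions.measurable_apply [MeasurableSpace V] {ι : V →L[ℝ] H}
    {F₀ F₁ : MeasurableSpace Ω} {S : U →L[ℝ] U} {A : V → Ω → StrongDual ℝ V}
    {B : V → Ω → HilbertSchmidt (CameronMartin S) H} {p κ c μ ν : ℝ}
    (hAB : OperatorAssumptions ι F₀ S A B p κ c μ ν) (hF : F₀ ≤ F₁) {Y : Ω → V}
    (hY : Measurable[F₁] Y) : Measurable[F₁] fun ω => B (Y ω) ω := by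
  have hpair : Measurable[F₁, Prod.instMeasurableSpace (m₂ := F₀)] fun ω => (Y ω, ω) :=
    Measurable.prodMk hY (measurable_id'' hF)
  exact hAB.measurable_B.comp hpair

end Scheme

theorem theorem3p2 {U V H Ω : Type*}
    [NormedAddCommGroup U] [InnerProductSpace ℝ U] [CompleteSpace U]
    [TopologicalSpace.SeparableSpace U]
    [NormedAddCommGroup H] [InnerProductSpace ℝ H] [CompleteSpace H]
    [TopologicalSpace.SeparableSpace H]
    [NormedAddCommGroup V] [NormedSpace ℝ V] [CompleteSpace V]
    [TopologicalSpace.SeparableSpace V] [MeasurableSpace V] [BorelSpace V]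
    -- `V` is reflexive, and continuously and densely embedded in `H`
    (hV : Function.Surjective (NormedSpace.inclusionInDoubleDual ℝ V))
    (ι : V →L[ℝ] H) (hι : Function.Injective ι) (hdense : DenseRange ι)
    -- a filtered probability space that satisfies the usual conditions
    {m : MeasurableSpace Ω} (P : Measure Ω) [IsProbabilityMeasure P]
    {T : ℝ} (hT : 0 < T) (F : Filtration (Set.Icc (0 : ℝ) T) m) [F.IsRightContinuous]
    (hnull : ∀ t, ∀ s : Set Ω, P s = 0 → MeasurableSet[F t] s)
    -- the covariance operator `Q`, its square root `S`, and the Wiener process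
    (Q S : U →L[ℝ] U) (hQ : Q.IsPositive) (hS : S.IsPositive) (hSQ : S ∘L S = Q)
    (W : Set.Icc (0 : ℝ) T → U → Ω → ℝ) (hW : IsWienerProcess P F Q W)
    -- the operators
    (A : V → Ω → StrongDual ℝ V) (B : V → Ω → HilbertSchmidt (CameronMartin S) H)
    (p κ c μ ν : ℝ) (hp : 1 < p)
    (hAB : OperatorAssumptions ι (F ⟨0, le_rfl, hT.le⟩) S A B p κ c μ ν)
    -- the discretization parameters; `k = T / N`
    (Vh : Submodule ℝ V) [FiniteDimensional ℝ Vh]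
    (N : ℕ) (hN : 0 < N) (k : ℝ) (hk : k = T / N) (hkκ : 2 * k * κ < 1)
    -- the discrete process: adapted, almost surely `Vh`-valued, with admissible initial values
    (X : ℕ → Ω → H)
    (hX : ∀ n ≤ N, StronglyMeasurable[F (gridPoint hT N n)] (X n))
    (hXVh : ∀ n ≤ N, ∀ᵐ ω ∂P, X n ω ∈ ι '' Vh)
    (hXL2 : ∀ n ≤ 1, MemLp (X n) 2 P)
    (hBL2 : ∀ n ≤ 1, AEStronglyMeasurable[F (gridPoint hT N n)] (fun ω => B (toV ι (X n ω)) ω) P ∧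
      MemLp (fun ω => B (toV ι (X n ω)) ω) 2 P)
    (hBDF2 : SolvesBDF2 ι P hT Q S W A B Vh N X) :
    (⨆ n ∈ Finset.Icc 2 N, (∫⁻ ω, ‖X n ω‖ₑ ^ 2 ∂P
        + ENNReal.ofReal (2 * k * ν) * ∫⁻ ω, ‖B (toV ι (X n ω)) ω‖ₑ ^ 2 ∂P))
      + ENNReal.ofReal (2 * k * μ) *
          ∑ n ∈ Finset.Icc 2 N, ∫⁻ ω, ‖toV ι (X n ω)‖ₑ ^ p ∂P
      + ENNReal.ofReal ((ν - 1) / ν) *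
          ∑ n ∈ Finset.Icc 2 N, ∫⁻ ω, ‖X n ω - (2 : ℝ) • X (n - 1) ω + X (n - 2) ω‖ₑ ^ 2 ∂P
    ≤ ENNReal.ofReal (2 * max (2 * c) (max 11 (2 * ν)) * (1 - 2 * k * κ)⁻¹
          * Real.exp (2 * κ * T * (1 - 2 * k * κ)⁻¹)) *
        (ENNReal.ofReal T + ∑ n ∈ Finset.range 2, ∫⁻ ω, ‖X n ω‖ₑ ^ 2 ∂P
          + ENNReal.ofReal k *
              ∑ n ∈ Finset.range 2, ∫⁻ ω, ‖B (toV ι (X n ω)) ω‖ₑ ^ 2 ∂P) := by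
  obtain ⟨g, hgVh, hg⟩ := exists_continuousLinearMap_leftInverse hι Vh
  obtain ⟨D, hD, hsol⟩ := hBDF2
  have hκ := hAB.κ_nonneg
  have hc := hAB.c_nonneg
  have hμ := hAB.μ_pos
  have hν := hAB.one_le_ν
  have hN' : (0 : ℝ) < N := by exact_mod_cast hN
  have hk0 : 0 < k := by rw [hk]; positivity
  have hkN : k * N = T := by rw [hk]; field_simp
  -- `g (X n)` is a measurable version of `toV ι (X n)`
  have hXg : ∀ n ≤ N, ∀ᵐ ω ∂P, ι (g (X n ω)) = X n ω ∧ toV ι (X n ω) = g (X n ω) := by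
    intro n hn
    filter_upwards [hXVh n hn] with ω hω
    obtain ⟨v, hv, hvX⟩ := hω
    rw [← hvX, hg v hv]
    exact ⟨rfl, Function.leftInverse_invFun hι v⟩
  set Y : ℕ → Ω → V := fun n ω => g (X n ω) with hYdef
  have hYm : ∀ n ≤ N, StronglyMeasurable[F (gridPoint hT N n)] (Y n) := fun n hn =>
    g.continuous.comp_stronglyMeasurable (hX n hn)
  have hBm : ∀ n ≤ N, Measurable[F (gridPoint hT N n)] fun ω => B (Y n ω) ω := fun n hn =>
    hAB.measurable_apply (F.mono (gridPoint hT N n).2.1) (hYm n hn).measurable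
  have hBY : ∀ n ≤ N, (fun ω => B (toV ι (X n ω)) ω) =ᵐ[P] fun ω => B (Y n ω) ω := by
    intro n hn
    filter_upwards [hXg n hn] with ω hω
    rw [hω.2]
  have hβ1 : ∀ n ≤ 1, Integrable (fun ω => ‖B (Y n ω) ω‖ ^ 2) P := by
    intro n hn
    refine (integrable_sq_norm_of_memLp_two (hBL2 n hn).2).congr ?_
    filter_upwards [hBY n (by omega)] with ω hω
    rw [hω]
  have hscheme : IsEnergyScheme P (fun n => F (gridPoint hT N n)) X D
      (fun n ω => ‖B (Y n ω) ω‖) (fun n ω => ‖Y n ω‖ ^ p) k κ c μ ν N := by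
    refine ⟨fun n _ => F.mono (gridPoint_mono hT N n.le_succ), fun n => F.le _, hX, ?_, ?_,
      fun n ω => by positivity, ?_, ?_⟩
    · exact fun n hn => ((measurable_norm.comp (hBm n hn)).mono (F.le _) le_rfl).aestronglyMeasurable
    · intro n hn
      have h1 := ((hYm n hn).mono (F.le _)).norm.measurable.pow_const p
      exact h1.aestronglyMeasurable
    · intro n hn hint
      have h1 := (hD (n + 1) (by omega) hn).congr (hBY n (by omega))
      have h2 := h1.properties hW (hnull _) hQ hS hSQ (gridPoint_mono hT N (Nat.le_add_right n 1))
        (hBm n (by omega)) hint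
      have h3 : (gridPoint hT N (n + 1) : ℝ) - gridPoint hT N n = k := by
        rw [coe_gridPoint hT hN hn, coe_gridPoint hT hN (by omega), hk]
        push_cast
        ring
      rw [h3] at h2
      exact h2
    · intro n hn
      have h1 := ae_forall_mem_of_forall_mem_ae (P := P) Vh
        (f := fun ω => (innerSL ℝ ((3 / 2 : ℝ) • X (n + 2) ω - (2 : ℝ) • X (n + 1) ω
          + (1 / 2 : ℝ) • X n ω) ∘L ι + (T / N) • A (toV ι (X (n + 2) ω)) ω : V →L[ℝ] ℝ))
        (g := fun ω => (innerSL ℝ ((3 / 2 : ℝ) • D (n + 2) ω - (1 / 2 : ℝ) • D (n + 1) ω) ∘L ι :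
          V →L[ℝ] ℝ)) (hsol (n + 2) (by omega) hn)
      filter_upwards [h1, hXg (n + 2) hn] with ω hω hXω
      have h2 : inner ℝ ((3 / 2 : ℝ) • X (n + 2) ω - (2 : ℝ) • X (n + 1) ω + (1 / 2 : ℝ) • X n ω)
            (ι (Y (n + 2) ω)) + T / N * A (toV ι (X (n + 2) ω)) ω (Y (n + 2) ω)
          = inner ℝ ((3 / 2 : ℝ) • D (n + 2) ω - (1 / 2 : ℝ) • D (n + 1) ω) (ι (Y (n + 2) ω)) :=
        hω _ (hgVh _)
      rw [hXω.2, hXω.1, ← hk] at h2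
      have h3 := hAB.coercive (Y (n + 2) ω) ω
      rw [hXω.1] at h3
      have h4 := mul_le_mul_of_nonneg_left h3 hk0.le
      have h5 : inner ℝ ((6 : ℝ) • D (n + 2) ω - (2 : ℝ) • D (n + 1) ω) (X (n + 2) ω)
          = 4 * inner ℝ ((3 / 2 : ℝ) • D (n + 2) ω - (1 / 2 : ℝ) • D (n + 1) ω) (X (n + 2) ω) := by
        simp only [inner_sub_left, real_inner_smul_left]
        ring
      rw [h5, ← h2]
      linarith
  have hint := hscheme.memLp_and_integrable hk0 hμ hν hkκ hXL2 hβ1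
  have hη : ∀ n, n + 2 ≤ N → Integrable (fun ω => ‖Y (n + 2) ω‖ ^ p) P := fun n hn =>
    (hscheme.integrable_succ hk0 hμ hν hkκ hn (hint n (by omega)).1 (hint (n + 1) (by omega)).1
      (hint n (by omega)).2 (hint (n + 1) (by omega)).2).2.2
  have hmain := hscheme.expectation_le hk0 hκ hc hμ hν hkκ hkN hXL2 hβ1
  -- all the expectations are finite, so that they are given by real integrals
  have ex : ∀ n ≤ N, ∫⁻ ω, ‖X n ω‖ₑ ^ 2 ∂P = ENNReal.ofReal (∫ ω, ‖X n ω‖ ^ 2 ∂P) := fun n hn =>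
    lintegral_enorm_sq_eq_ofReal (integrable_sq_norm_of_memLp_two (hint n hn).1)
  have eb : ∀ n ≤ N, ∫⁻ ω, ‖B (toV ι (X n ω)) ω‖ₑ ^ 2 ∂P
      = ENNReal.ofReal (∫ ω, ‖B (Y n ω) ω‖ ^ 2 ∂P) := by
    intro n hn
    rw [← lintegral_enorm_sq_eq_ofReal (hint n hn).2]
    refine lintegral_congr_ae ?_
    filter_upwards [hBY n hn] with ω hω
    rw [hω]
  have eq : ∀ n ∈ Finset.Icc 2 N, ∫⁻ ω, ‖toV ι (X n ω)‖ₑ ^ p ∂P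
      = ENNReal.ofReal (∫ ω, ‖Y n ω‖ ^ p ∂P) := by
    intro n hn
    obtain ⟨h2n, hnN⟩ := Finset.mem_Icc.1 hn
    obtain ⟨i, rfl⟩ := Nat.exists_eq_add_of_le' h2n
    rw [ofReal_integral_eq_lintegral_ofReal (hη i hnN) (ae_of_all _ fun ω => by positivity)]
    refine lintegral_congr_ae ?_
    filter_upwards [hXg _ hnN] with ω hω
    rw [hω.2, ← ENNReal.ofReal_rpow_of_nonneg (norm_nonneg _) (by linarith), ofReal_norm]
  have eδ : ∀ n ∈ Finset.Icc 2 N, ∫⁻ ω, ‖X n ω - (2 : ℝ) • X (n - 1) ω + X (n - 2) ω‖ₑ ^ 2 ∂P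
      = ENNReal.ofReal (∫ ω, ‖X n ω - (2 : ℝ) • X (n - 1) ω + X (n - 2) ω‖ ^ 2 ∂P) := by
    intro n hn
    obtain ⟨-, hnN⟩ := Finset.mem_Icc.1 hn
    have hd : MemLp (fun ω => X n ω - (2 : ℝ) • X (n - 1) ω + X (n - 2) ω) 2 P :=
      ((hint n hnN).1.sub ((hint (n - 1) (by omega)).1.const_smul (2 : ℝ))).add
        (hint (n - 2) (by omega)).1
    exact lintegral_enorm_sq_eq_ofReal (integrable_sq_norm_of_memLp_two hd)
  set x : ℕ → ℝ := fun n => ∫ ω, ‖X n ω‖ ^ 2 ∂P with hx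
  set b : ℕ → ℝ := fun n => ∫ ω, ‖B (Y n ω) ω‖ ^ 2 ∂P with hb
  set δ : ℕ → ℝ := fun n => ∫ ω, ‖X n ω - (2 : ℝ) • X (n - 1) ω + X (n - 2) ω‖ ^ 2 ∂P with hδ
  set q : ℕ → ℝ := fun n => ∫ ω, ‖Y n ω‖ ^ p ∂P with hq
  have hx0 : ∀ n, 0 ≤ x n := fun n => integral_nonneg fun _ => sq_nonneg _
  have hb0 : ∀ n, 0 ≤ b n := fun n => integral_nonneg fun _ => sq_nonneg _
  have hδ0 : ∀ n, 0 ≤ δ n := fun n => integral_nonneg fun _ => sq_nonneg _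
  have hq0 : ∀ n, 0 ≤ q n := fun n => integral_nonneg fun _ => by positivity
  have hν1 : 0 ≤ 1 - ν⁻¹ := sub_nonneg.2 (inv_le_one_of_one_le₀ hν)
  have hkν : 0 ≤ 2 * k * ν := by positivity
  have hkμ : 0 ≤ 2 * k * μ := by positivity
  have hνeq : (ν - 1) / ν = 1 - ν⁻¹ := by field_simp
  set C := max (2 * c) (max 11 (2 * ν)) * (1 - 2 * k * κ)⁻¹
    * Real.exp (2 * κ * T * (1 - 2 * k * κ)⁻¹) with hC
  have hC0 : 0 ≤ C := by
    have : 0 < 1 - 2 * k * κ := sub_pos.2 hkκ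
    positivity
  set I := T + (x 0 + x 1) + k * (b 0 + b 1) with hI
  have hsumq : ∀ M, 0 ≤ 2 * k * μ * ∑ n ∈ Finset.Icc 2 M, q n := fun M =>
    mul_nonneg hkμ (Finset.sum_nonneg fun n _ => hq0 n)
  have hsumδ : ∀ M, 0 ≤ (1 - ν⁻¹) * ∑ n ∈ Finset.Icc 2 M, δ n := fun M =>
    mul_nonneg hν1 (Finset.sum_nonneg fun n _ => hδ0 n)
  have hI0 : 0 ≤ I := by
    have := hx0 0; have := hx0 1; have := hb0 0; have := hb0 1
    positivity
  -- the maximum and the two sums are bounded separately, which doubles the constant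
  have hmax : (⨆ n ∈ Finset.Icc 2 N, (∫⁻ ω, ‖X n ω‖ₑ ^ 2 ∂P
      + ENNReal.ofReal (2 * k * ν) * ∫⁻ ω, ‖B (toV ι (X n ω)) ω‖ₑ ^ 2 ∂P))
      ≤ ENNReal.ofReal (C * I) := by
    refine iSup₂_le fun n hn => ?_
    obtain ⟨h2n, hnN⟩ := Finset.mem_Icc.1 hn
    obtain ⟨M, rfl⟩ := Nat.exists_eq_add_of_le' (show 1 ≤ n by omega)
    rw [ex _ hnN, eb _ hnN, ← ENNReal.ofReal_mul hkν,
      ← ENNReal.ofReal_add (hx0 _) (mul_nonneg hkν (hb0 _))]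
    refine ENNReal.ofReal_le_ofReal ?_
    linarith [hmain M hnN, hsumq (M + 1), hsumδ (M + 1)]
  have hsums : ENNReal.ofReal (2 * k * μ) * ∑ n ∈ Finset.Icc 2 N, ∫⁻ ω, ‖toV ι (X n ω)‖ₑ ^ p ∂P
      + ENNReal.ofReal ((ν - 1) / ν) *
          ∑ n ∈ Finset.Icc 2 N, ∫⁻ ω, ‖X n ω - (2 : ℝ) • X (n - 1) ω + X (n - 2) ω‖ₑ ^ 2 ∂P
      ≤ ENNReal.ofReal (C * I) := by
    rw [Finset.sum_congr rfl eq, Finset.sum_congr rfl eδ,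
      ← ENNReal.ofReal_sum_of_nonneg fun n _ => hq0 n,
      ← ENNReal.ofReal_sum_of_nonneg fun n _ => hδ0 n, ← ENNReal.ofReal_mul hkμ, hνeq,
      ← ENNReal.ofReal_mul hν1, ← ENNReal.ofReal_add (hsumq N) (hsumδ N)]
    refine ENNReal.ofReal_le_ofReal ?_
    obtain ⟨M, rfl⟩ := Nat.exists_eq_add_of_le' hN
    linarith [hmain M le_rfl, hx0 (M + 1), mul_nonneg hkν (hb0 (M + 1))]
  have hrhs : ENNReal.ofReal T + ∑ n ∈ Finset.range 2, ∫⁻ ω, ‖X n ω‖ₑ ^ 2 ∂P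
      + ENNReal.ofReal k * ∑ n ∈ Finset.range 2, ∫⁻ ω, ‖B (toV ι (X n ω)) ω‖ₑ ^ 2 ∂P
      = ENNReal.ofReal I := by
    rw [Finset.sum_range_succ, Finset.sum_range_one, Finset.sum_range_succ, Finset.sum_range_one,
      ex 0 (by omega), ex 1 hN, eb 0 (by omega), eb 1 hN, ← ENNReal.ofReal_add (hx0 0) (hx0 1),
      ← ENNReal.ofReal_add (hb0 0) (hb0 1), ← ENNReal.ofReal_mul hk0.le,
      ← ENNReal.ofReal_add hT.le (add_nonneg (hx0 0) (hx0 1)),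
      ← ENNReal.ofReal_add (add_nonneg hT.le (add_nonneg (hx0 0) (hx0 1)))
        (mul_nonneg hk0.le (add_nonneg (hb0 0) (hb0 1)))]
  rw [hrhs, add_assoc]
  refine (add_le_add hmax hsums).trans_eq ?_
  rw [← ENNReal.ofReal_add (mul_nonneg hC0 hI0) (mul_nonneg hC0 hI0), hC,
    ← ENNReal.ofReal_mul (by rw [hC] at hC0; linarith)]
  congr 1
  ring
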